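/- Conventions. A geodesic segment $[x,y]$ in a metric space is the image of an isometric embedding of $[0,d(x,y)]$ that sends $0$ to $x$ and $d(x,y)$ to $y$. An $\mathbb R$-tree is a metric space in which any two points are connected by a unique geodesic segment, and in which $[x,y]\cap[y,z]=\{y\}$ implies $[x,y]\cup[y,z]=[x,z]$. A locally finite tree is a connected acyclic locally finite graph with the geodesic metric in which every edge is isometric to the unit segment. An open or half-open segment (with distinct end points) in an $\mathbb R$-tree $T$ is free if it is an open subset of $T$, and the mesh of $T$ is the greatest lower bound of the diameters of the maximal free open or half-open segments in $T$. A regular $\mathbb R$-tree is an $\mathbb R$-tree $T$ together with subspaces $T=T_0\supset T_1\supset T_2\supset\cdots$ that are $\mathbb R$-trees, such that (1) $\bigcap_i T_i=\emptyset$; (2) each $T_i\setminus T_{i+1}$ is the disjoint union of a uniformly bounded family of half-open segments that are maximal free segments in $T_i$; (3) the meshes $D_i$ of $T_i$ satisfy $D_0<D_1<\cdots$ and $D_i\to\infty$. It is binary regular if $D_i=2^i$ for all $i$. The canonical retraction $r_i\colon T\to T_i$ is the identity on $T_i$ and maps every component $C$ of $T\setminus T_i$ to the single point of $\partial C$. For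 regular $\mathbb R$-trees $T^0,\dots,T^n$, with filtrations $(T^i_j)_{j\ge 0}$ and canonical retractions $r^i_j\colon T^i\to T^i_j$, let $$M(T^0,\dots,T^n)=\bigcap_{j\ge1}\Big\{(x_0,\dots,x_n)\in\prod_{i=0}^nT^i \;\Big|\; r^i_j(x_i)\in\partial\,(T^i_{j-1}\setminus T^i_j)\text{ for some }i\Big\},$$ with the sup-metric of the product, and let $\mathcal M_n$ be the class of all such spaces. A metric space $X$ has $\operatorname{asdim}X\le n$ if for every $D>0$ it has a uniformly bounded cover $\mathcal U^0\cup\dots\cup\mathcal U^n$ in which any two distinct members of the same $\mathcal U^i$ are at distance at least $D$. A map $f\colon X\to Y$ of metric spaces is a large scale embedding if there are non-decreasing functions $\varphi_1,\varphi_2\colon[0,\infty)\to[0,\infty)$ that tend to $\infty$ at $\infty$ with $\varphi_1(d(x,x'))\le d(f(x),f(x'))\le\varphi_2(d(x,x'))$ for all $x,x'\in X$. Theorem. Let $n\ge0$. For every proper metric space $X$ with $\operatorname{asdim}X\le n$ there exist locally finite binary regular trees $T^0,\dots,T^n$ and a large scale embedding of $X$ into $M(T^0,\dots,T^n)$. In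 particular, the class $\mathcal M_n$ is universal for the class of proper metric spaces of asymptotic dimension at most $n$: every such space has a large scale embedding into some member of $\mathcal M_n$. -/

import Mathlib

open Set Filter
open scoped NNReal

universe u

/-! ### Large scale geometry -/

/-- `asdim X ≤ n`: for every `D > 0` there is a uniformly bounded cover of `X` that is the union
of `n + 1` families, each of which is `D`-disjoint. -/
def AsdimLE (X : Type u) [MetricSpace X] (n : ℕ) : Prop :=
  ∀ D : ℝ, 0 < D → ∃ 𝒰 : Fin (n + 1) → Set (Set X),
    (∀ x : X, ∃ i, ∃ A ∈ 𝒰 i, x ∈ A) ∧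
    (∃ C : ℝ, ∀ i, ∀ A ∈ 𝒰 i, ∀ a ∈ A, ∀ b ∈ A, dist a b ≤ C) ∧
    (∀ i, ∀ A ∈ 𝒰 i, ∀ B ∈ 𝒰 i, A ≠ B → ∀ a ∈ A, ∀ b ∈ B, D ≤ dist a b)

/-- Large scale (coarse) embeddings, with control functions `[0, ∞) → [0, ∞)`. -/
def IsLargeScaleEmbedding {X Y : Type*} [MetricSpace X] [MetricSpace Y] (f : X → Y) : Prop :=
  ∃ φ₁ φ₂ : ℝ≥0 → ℝ≥0, Monotone φ₁ ∧ Monotone φ₂ ∧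
    Tendsto φ₁ atTop atTop ∧ Tendsto φ₂ atTop atTop ∧
    ∀ x y : X, φ₁ (nndist x y) ≤ nndist (f x) (f y) ∧ nndist (f x) (f y) ≤ φ₂ (nndist x y)

/-! ### Real trees -/

/-- `S` is a geodesic segment connecting `x` and `y`: the image of an isometric embedding of
`[0, d(x, y)]` that sends `0` to `x` and `d(x, y)` to `y`. -/
def IsGeodesicSegment {T : Type*} [MetricSpace T] (x y : T) (S : Set T) : Prop :=
  ∃ j : ℝ → T, (∀ s ∈ Icc 0 (dist x y), ∀ t ∈ Icc 0 (dist x y), dist (j s) (j t) = |s - t|) ∧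
    j 0 = x ∧ j (dist x y) = y ∧ S = j '' Icc 0 (dist x y)

/-- An `ℝ`-tree: any two points are connected by a unique geodesic segment, and two segments
`[x, y]`, `[y, z]` that meet only in `y` have union `[x, z]`. -/
structure IsRTree (T : Type*) [MetricSpace T] : Prop where
  existsUnique_segment : ∀ x y : T, ∃! S : Set T, IsGeodesicSegment x y S
  union_segment : ∀ (x y z : T) (S S' : Set T), IsGeodesicSegment x y S →
    IsGeodesicSegment y z S' → S ∩ S' = {y} → IsGeodesicSegment x z (S ∪ S')

/-- A locally finite tree: a connected acyclic locally finite graph, regarded as a geodesic metric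
space in which every edge is isometric to the unit segment. Here the vertex set `V` is a subset
of the space, the distance of two vertices is their distance in the graph, and the space consists
of the vertices and of the points on the edges. -/
def IsLocallyFiniteTree (T : Type*) [MetricSpace T] : Prop :=
  IsRTree T ∧ ∃ (V : Set T) (G : SimpleGraph V),
    G.IsTree ∧ (∀ v, (G.neighborSet v).Finite) ∧
    (∀ v w : V, dist (v : T) (w : T) = (G.dist v w : ℝ)) ∧
    ∀ x : T, x ∈ V ∨ ∃ (v w : V) (S : Set T), G.Adj v w ∧ IsGeodesicSegment (v : T) (w : T) S ∧ x ∈ S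

/-- Half-open segments `[x, y)` and `(x, y]` with distinct end points (up to exchanging the names
of the end points). -/
def IsHalfOpenSegment {T : Type*} [MetricSpace T] (S : Set T) : Prop :=
  ∃ (x y : T) (S' : Set T), x ≠ y ∧ IsGeodesicSegment x y S' ∧ S = S' \ {y}

/-- Open segments `(x, y)` with distinct end points. -/
def IsOpenSegment {T : Type*} [MetricSpace T] (S : Set T) : Prop :=
  ∃ (x y : T) (S' : Set T), x ≠ y ∧ IsGeodesicSegment x y S' ∧ S = S' \ {x, y}

/-- A (half-)open segment is free if it is an open subset of the tree. -/
def IsFreeSegment {T : Type*} [MetricSpace T] (S : Set T) : Prop :=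
  (IsHalfOpenSegment S ∨ IsOpenSegment S) ∧ IsOpen S

/-- `D` is the mesh of `T`: the greatest lower bound of the diameters of the maximal
free (half-)open segments in `T`. (It does not exist if there are no such segments.) -/
def IsMesh (T : Type*) [MetricSpace T] (D : ℝ) : Prop :=
  IsGLB {r : ℝ | ∃ S : Set T, Maximal IsFreeSegment S ∧ r = Metric.diam S} D

/-- A filtration `T = T₀ ⊇ T₁ ⊇ T₂ ⊇ …` by `ℝ`-trees which makes `T` a regular `ℝ`-tree, where
`D i` is the mesh of `Tᵢ`. -/
structure IsRegularFiltration {T : Type*} [MetricSpace T] (F : ℕ → Set T) (D : ℕ → ℝ) : Prop where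
  zero : F 0 = univ
  antitone : Antitone F
  isRTree : ∀ i, IsRTree (F i)
  iInter : ⋂ i, F i = ∅
  /-- `Tᵢ \ Tᵢ₊₁` is a disjoint union of a uniformly bounded family of half-open segments that are
  maximal free segments in `Tᵢ`. -/
  diff : ∀ i, ∃ 𝒮 : Set (Set (F i)),
    (∀ S ∈ 𝒮, IsHalfOpenSegment S ∧ Maximal IsFreeSegment S) ∧
    (∃ C : ℝ, ∀ S ∈ 𝒮, Metric.diam S ≤ C) ∧
    𝒮.PairwiseDisjoint id ∧
    ⋃₀ 𝒮 = {x : F i | (x : T) ∉ F (i + 1)}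
  mesh : ∀ i, IsMesh (F i) (D i)
  strictMono : StrictMono D
  tendsto : Tendsto D atTop atTop

/-- The filtration makes `T` a regular `ℝ`-tree. -/
def IsRegularTree {T : Type*} [MetricSpace T] (F : ℕ → Set T) : Prop :=
  ∃ D : ℕ → ℝ, IsRegularFiltration F D

/-- The filtration makes `T` a binary regular `ℝ`-tree: the mesh of `Tᵢ` is `2 ^ i`. -/
def IsBinaryRegularTree {T : Type*} [MetricSpace T] (F : ℕ → Set T) : Prop :=
  IsRegularFiltration F (fun i => (2 : ℝ) ^ i)

/-! ### The "`n`-skeleton" of a product of regular trees -/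

/-- `y = r(x)` for the canonical retraction `r` of `T` onto its subtree `A`: it fixes the points
of `A` and maps every component `C` of `T \ A` to the unique point of the boundary of `C`. -/
def CanonicalRetract {T : Type*} [MetricSpace T] (A : Set T) (x y : T) : Prop :=
  (x ∈ A ∧ y = x) ∨ (x ∉ A ∧ frontier (connectedComponentIn Aᶜ x) = {y})

/-- The space `M(T⁰, …, Tⁿ) = ⋂_{j ≥ 1} M_j`, where `M_j` consists of all points `x` of the product
such that `r_j(x_i)` lies in the boundary of `T^i_{j-1} \ T^i_j` for some `i`, with `r_j` the
canonical retraction of `T^i` onto `T^i_j`. (The index below is `j - 1`. A point of `T^i_j` is in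
the boundary with respect to `T^i` if and only if it is so with respect to `T^i_{j-1}`.) As a
subset of a finite product it carries the sup-metric. -/
def treeSkeleton {n : ℕ} {T : Fin (n + 1) → Type u} [∀ i, MetricSpace (T i)]
    (F : ∀ i, ℕ → Set (T i)) : Set (∀ i, T i) :=
  {x | ∀ j : ℕ, ∃ i, ∃ y : T i, CanonicalRetract (F i (j + 1)) (x i) y ∧
    y ∈ frontier (F i j \ F i (j + 1))}

/-! ### Universal classes -/

/-- Classes of metric spaces. -/
abbrev MetricClass : Type (u + 1) := (X : Type u) → [MetricSpace X] → Prop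

/-- The class `𝒞` is universal for the class `𝒟`: every member of `𝒟` has a large scale embedding
into some member of `𝒞`. -/
def MetricClass.IsUniversalFor (𝒞 𝒟 : MetricClass.{u}) : Prop :=
  ∀ (X : Type u) [MetricSpace X], 𝒟 X →
    ∃ (Y : Type u) (_ : MetricSpace Y), 𝒞 Y ∧ ∃ f : X → Y, IsLargeScaleEmbedding f

/-- The class `ℳ_n` of the spaces (isometric to one) of the form `M(T⁰, …, Tⁿ)`, where
`T⁰, …, Tⁿ` are regular `ℝ`-trees. -/
def skeletonClass (n : ℕ) : MetricClass.{u} := fun Y _ =>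
  ∃ (T : Fin (n + 1) → Type u) (_ : ∀ i, MetricSpace (T i)) (F : ∀ i, ℕ → Set (T i)),
    (∀ i, IsRTree (T i)) ∧ (∀ i, IsRegularTree (F i)) ∧ Nonempty (Y ≃ᵢ treeSkeleton F)

/-- The class of proper metric spaces of asymptotic dimension at most `n`. -/
def properAsdimClass (n : ℕ) : MetricClass.{u} := fun X _ => ProperSpace X ∧ AsdimLE X n

/-! ### Trees with a height function -/

/-! Fix a base point. For each of the `n + 1` colours, covers of `X` at growing scales are turned
into a tower: for every `k` a uniformly bounded separated family, and a function `depth k` with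
values in `0, …, 2 ^ k`, equal to `2 ^ k` exactly outside the family and coarsely `1`-Lipschitz. At
every level each point has depth `0` in some colour. The key condition is that `depth k` is constant
on each member of level `l < k`, with a value divisible by `2 ^ l`. A member of level `l` thus
becomes an edge of length `2 ^ l` whose upper end is glued to a single point of the edge of the next
larger member. The ray of `x` climbs through the members containing `x`, covering the length `2 ^ k
- depth k x` on an edge of level `k`.

Upper bound (`dist_toTree_le`): below the first level with a member containing both `x` and `y`,
each climb is at most `dist x y + 1`, and divisibility bounds the sum of all climbs by three times
this (`entry_le`). Lower bound (`le_dist_toTree`): in a colour where `x` has depth `0` at level `k`,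
its ray traverses a whole edge of length `2 ^ k`, so either `y` is in the same bounded member or the
images are `2 ^ k` apart. The same vanishing puts the image into the skeleton: the ray enters level
`k` at the lower end of an edge and is retracted to that end.

The depth functions come from `Separates.constOn`: steps of height `m` in widely separated shells
around a set are added up, so that the additive error stays `1` through all levels. Regularity is
forced by `decorate`, which glues pairs of short edges at all admissible places. Then the multiples
of `2 ^ k` on edges of higher level that carry other edges are branch points of the `k`-th subtree,
and its maximal free segments have length at least `2 ^ k`. The tree axioms follow from a height
function, since in all these trees any two upward rays merge. -/

/-- The order data of a real tree in which all points have a common direction "up": the height of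
a point, the point `up p t` at height `t` above `p` (which is `p` if `t` is too small), and the
height `join p q` at which the upward rays from `p` and `q` merge. -/
structure HeightData (T : Type*) where
  height : T → ℝ
  up : T → ℝ → T
  join : T → T → ℝ
  height_up : ∀ p t, height (up p t) = max (height p) t
  up_of_le : ∀ p t, t ≤ height p → up p t = p
  up_up : ∀ p s t, up (up p s) t = up p (max s t)
  le_join_left : ∀ p q, height p ≤ join p q
  le_join_right : ∀ p q, height q ≤ join p q
  up_eq_up_iff : ∀ p q t, height p ≤ t → height q ≤ t → (up p t = up q t ↔ join p q ≤ t)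

namespace HeightData

variable {T : Type*} (h : HeightData T)

lemma up_self (p : T) : h.up p (h.height p) = p := h.up_of_le p _ le_rfl

lemma height_up_of_le {p : T} {t : ℝ} (ht : h.height p ≤ t) : h.height (h.up p t) = t := by
  rw [h.height_up, max_eq_right ht]

lemma up_up_of_le (p : T) {s t : ℝ} (hst : s ≤ t) : h.up (h.up p s) t = h.up p t := by
  rw [h.up_up, max_eq_right hst]

lemma up_join (p q : T) : h.up p (h.join p q) = h.up q (h.join p q) :=
  (h.up_eq_up_iff p q _ (h.le_join_left p q) (h.le_join_right p q)).2 le_rfl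

lemma up_eq_up {p q : T} {t : ℝ} (ht : h.join p q ≤ t) : h.up p t = h.up q t :=
  (h.up_eq_up_iff p q _ ((h.le_join_left p q).trans ht) ((h.le_join_right p q).trans ht)).2 ht

lemma join_le {p q : T} {t : ℝ} (hp : h.height p ≤ t) (hq : h.height q ≤ t)
    (e : h.up p t = h.up q t) : h.join p q ≤ t :=
  (h.up_eq_up_iff p q _ hp hq).1 e

lemma join_comm (p q : T) : h.join p q = h.join q p :=
  le_antisymm (h.join_le (h.le_join_right q p) (h.le_join_left q p) (h.up_join q p).symm)
    (h.join_le (h.le_join_right p q) (h.le_join_left p q) (h.up_join p q).symm)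

/-- Once two rays have merged they stay together. This ultrametric inequality gives the triangle
inequality and the medians. -/
lemma join_le_max (p q r : T) : h.join p r ≤ max (h.join p q) (h.join q r) :=
  h.join_le ((h.le_join_left p q).trans (le_max_left _ _))
    ((h.le_join_right q r).trans (le_max_right _ _))
    ((h.up_eq_up (le_max_left _ _)).trans (h.up_eq_up (le_max_right _ _)))

lemma join_self (p : T) : h.join p p = h.height p :=
  le_antisymm (h.join_le le_rfl le_rfl rfl) (h.le_join_left p p)

lemma join_up {p : T} {t : ℝ} (ht : h.height p ≤ t) : h.join p (h.up p t) = t := by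
  refine le_antisymm (h.join_le ht (h.height_up_of_le ht).le (h.up_up_of_le p le_rfl).symm) ?_
  have := h.le_join_right p (h.up p t)
  rwa [h.height_up_of_le ht] at this

lemma eq_of_join_le {p q : T} (hp : h.join p q ≤ h.height p) (hq : h.join p q ≤ h.height q) :
    p = q := by
  have e : h.height p = h.height q :=
    le_antisymm ((h.le_join_left p q).trans hq) ((h.le_join_right p q).trans hp)
  rw [← h.up_self p, ← h.up_self q, ← e]
  exact h.up_eq_up hp

/-- The path metric. -/
@[reducible] noncomputable def metricSpace : MetricSpace T where
  dist p q := 2 * h.join p q - h.height p - h.height q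
  dist_self p := by rw [h.join_self]; ring
  dist_comm p q := by rw [h.join_comm]; ring
  dist_triangle p q r := by
    have h1 := h.le_join_right p q
    have h2 := h.le_join_left q r
    rcases le_max_iff.1 (h.join_le_max p q r) with h3 | h3 <;> linarith
  eq_of_dist_eq_zero {p q} e := by
    have h1 := h.le_join_left p q
    have h2 := h.le_join_right p q
    exact h.eq_of_join_le (by linarith) (by linarith)

end HeightData

/-- A metric space whose metric is the path metric of height data. -/
structure HeightTree (T : Type*) [MetricSpace T] extends HeightData T where
  dist_eq : ∀ p q, dist p q = 2 * join p q - height p - height q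

namespace HeightTree

variable {T : Type*} [MetricSpace T] (h : HeightTree T)

include h

/-- A subset that is closed under `up` inherits the structure. -/
noncomputable def restrict (A : Set T) (hA : ∀ p ∈ A, ∀ t, h.up p t ∈ A) : HeightTree A where
  height p := h.height p
  up p t := ⟨h.up p t, hA p p.2 t⟩
  join p q := h.join p q
  height_up p t := h.height_up p t
  up_of_le p t ht := Subtype.ext (h.up_of_le p t ht)
  up_up p s t := Subtype.ext (h.up_up p s t)
  le_join_left p q := h.le_join_left p q
  le_join_right p q := h.le_join_right p q
  up_eq_up_iff p q t hp hq := by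
    rw [Subtype.mk.injEq]; exact h.up_eq_up_iff p q t hp hq
  dist_eq p q := h.dist_eq p q

lemma abs_height_sub_le (p q : T) : |h.height p - h.height q| ≤ dist p q := by
  have h1 := h.le_join_left p q
  have h2 := h.le_join_right p q
  rw [h.dist_eq, abs_le]
  constructor <;> linarith

lemma dist_up {p : T} {t : ℝ} (ht : h.height p ≤ t) : dist p (h.up p t) = t - h.height p := by
  rw [h.dist_eq, h.join_up ht, h.height_up_of_le ht]; ring

lemma dist_up_up {p : T} {s t : ℝ} (hs : h.height p ≤ s) (ht : h.height p ≤ t) :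
    dist (h.up p s) (h.up p t) = |s - t| := by
  wlog hst : s ≤ t generalizing s t
  · rw [dist_comm, this ht hs (le_of_not_ge hst), abs_sub_comm]
  · rw [← h.up_up_of_le p hst, h.dist_up (by rwa [h.height_up_of_le hs]), h.height_up_of_le hs,
      abs_sub_comm, abs_of_nonneg (by linarith)]

/-- Climbing no further than the merging height does not change where the rays merge. -/
lemma dist_up_up_of_le_join {p q : T} {s t : ℝ} (hs : h.height p ≤ s) (hs' : s ≤ h.join p q)
    (ht : h.height q ≤ t) (ht' : t ≤ h.join p q) :
    dist (h.up p s) (h.up q t) = 2 * h.join p q - s - t := by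
  have : h.join (h.up p s) (h.up q t) = h.join p q := by
    apply le_antisymm
    · apply h.join_le (by rwa [h.height_up_of_le hs]) (by rwa [h.height_up_of_le ht])
      rw [h.up_up_of_le p hs', h.up_up_of_le q ht', h.up_join]
    · have h1 := h.le_join_left (h.up p s) (h.up q t)
      have h2 := h.le_join_right (h.up p s) (h.up q t)
      rw [h.height_up_of_le hs] at h1
      rw [h.height_up_of_le ht] at h2
      apply h.join_le (hs.trans h1) (ht.trans h2)
      rw [← h.up_up_of_le p h1, ← h.up_up_of_le q h2, h.up_join]
  rw [h.dist_eq, this, h.height_up_of_le hs, h.height_up_of_le ht]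

lemma dist_up_add_left {p q : T} {t : ℝ} (ht : h.height p ≤ t) (ht' : t ≤ h.join p q) :
    dist p (h.up p t) + dist (h.up p t) q = dist p q := by
  have := h.dist_up_up_of_le_join ht ht' le_rfl (h.le_join_right p q)
  rw [h.up_self] at this
  rw [this, h.dist_up ht, h.dist_eq]
  ring

lemma dist_up_add_right {p q : T} {t : ℝ} (ht : h.height q ≤ t) (ht' : t ≤ h.join p q) :
    dist p (h.up q t) + dist (h.up q t) q = dist p q := by
  rw [dist_comm p, dist_comm _ q, dist_comm p, add_comm]
  exact h.dist_up_add_left ht (by rwa [h.join_comm])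

/-- The points between `p` and `q` lie above `p` or above `q`. -/
lemma eq_up_of_between {p z q : T} (hz : dist p z + dist z q = dist p q) :
    (z = h.up p (h.height z) ∧ h.height p ≤ h.height z ∧ h.height z ≤ h.join p q) ∨
      (z = h.up q (h.height z) ∧ h.height q ≤ h.height z ∧ h.height z ≤ h.join p q) := by
  have h1 := h.le_join_left p z
  have h2 := h.le_join_right p z
  have h3 := h.le_join_left z q
  have h4 := h.le_join_right z q
  rw [h.dist_eq, h.dist_eq, h.dist_eq] at hz
  rcases le_max_iff.1 (h.join_le_max p z q) with h5 | h5
  · right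
    have : h.join z q = h.height z := by linarith
    refine ⟨?_, by linarith, by linarith⟩
    rw [← h.up_eq_up this.le, h.up_self]
  · left
    have : h.join p z = h.height z := by linarith
    refine ⟨?_, by linarith, by linarith⟩
    rw [h.up_eq_up this.le, h.up_self]

/-- Such points lie on the ascent from `p` or on the descent to `q`, where the distance from `p`
determines the height. If `z` and `w` lie on different sides, both are the merging point. -/
lemma eq_of_between {p q z w : T} (hz : dist p z + dist z q = dist p q)
    (hw : dist p w + dist w q = dist p q) (hzw : dist p z = dist p w) : z = w := by
  have hzw' : dist z q = dist w q := by linarith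
  have hJ := h.dist_eq p q
  rcases h.eq_up_of_between hz with ⟨e, h1, h2⟩ | ⟨e, h1, h2⟩ <;>
  rcases h.eq_up_of_between hw with ⟨e', h1', h2'⟩ | ⟨e', h1', h2'⟩
  · have d1 := h.dist_up h1
    have d2 := h.dist_up h1'
    rw [← e] at d1; rw [← e'] at d2
    rw [e, e', show h.height z = h.height w by linarith]
  · have d1 := h.dist_up h1
    have d2 := h.dist_up h1'
    rw [← e] at d1; rw [← e'] at d2
    rw [dist_comm w q] at hzw'
    rw [e, e', show h.height z = h.join p q by linarith, show h.height w = h.join p q by linarith,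
      h.up_join]
  · have d1 := h.dist_up h1
    have d2 := h.dist_up h1'
    rw [← e] at d1; rw [← e'] at d2
    rw [dist_comm z q] at hzw' hz
    rw [e, e', show h.height z = h.join p q by linarith, show h.height w = h.join p q by linarith,
      h.up_join]
  · have d1 := h.dist_up h1
    have d2 := h.dist_up h1'
    rw [← e] at d1; rw [← e'] at d2
    rw [dist_comm z q, dist_comm w q] at hzw'
    rw [e, e', show h.height z = h.height w by linarith]

/-- The point at distance `s` from `p` on the segment from `p` to `q`. -/
lemma exists_path (p q : T) : ∃ j : ℝ → T,
    (∀ s ∈ Icc 0 (dist p q), ∀ t ∈ Icc 0 (dist p q), dist (j s) (j t) = |s - t|) ∧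
    j 0 = p ∧ j (dist p q) = q := by
  have h1 := h.le_join_left p q
  have h2 := h.le_join_right p q
  have hd := h.dist_eq p q
  -- Climb from `p` to the merging height, then descend along the ray of `q`.
  refine ⟨fun s => if s ≤ h.join p q - h.height p then h.up p (h.height p + s) else
    h.up q (h.height q + (dist p q - s)), ?_, ?_, ?_⟩
  · intro s hs t ht
    wlog hst : s ≤ t generalizing s t
    · rw [dist_comm, this t ht s hs (le_of_not_ge hst), abs_sub_comm]
    simp only
    split_ifs with h3 h4 h4
    · rw [h.dist_up_up (by linarith [hs.1]) (by linarith [ht.1])]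
      congr 1; ring
    · rw [h.dist_up_up_of_le_join (by linarith [hs.1]) (by linarith [ht.1]) (by linarith [ht.2])
        (by linarith [ht.2]), abs_sub_comm, abs_of_nonneg (by linarith)]
      linarith
    · linarith
    · rw [h.dist_up_up (by linarith [hs.2]) (by linarith [ht.2]), abs_sub_comm]
      congr 1; ring
  · simp only
    rw [if_pos (by linarith), add_zero, h.up_self]
  · simp only
    split_ifs with h3
    · have h4 : h.join p q = h.height q := by linarith
      rw [show h.height p + dist p q = h.join p q by linarith, h.up_join, h4, h.up_self]
    · rw [sub_self, add_zero, h.up_self]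

/-- A geodesic takes every distance from `p`, so by `eq_of_between` it fills the metric interval, a
set that does not depend on the path. This is the uniqueness of segments. -/
lemma image_path_eq {p q : T} {j : ℝ → T}
    (hj : ∀ s ∈ Icc 0 (dist p q), ∀ t ∈ Icc 0 (dist p q), dist (j s) (j t) = |s - t|)
    (h0 : j 0 = p) (h1 : j (dist p q) = q) :
    j '' Icc 0 (dist p q) = {z | dist p z + dist z q = dist p q} := by
  have hl : (0 : ℝ) ∈ Icc 0 (dist p q) := ⟨le_rfl, dist_nonneg⟩
  have hr : dist p q ∈ Icc 0 (dist p q) := ⟨dist_nonneg, le_rfl⟩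
  have hp : ∀ s ∈ Icc 0 (dist p q), dist p (j s) = s := fun s hs => by
    have := hj 0 hl s hs
    rwa [h0, zero_sub, abs_neg, abs_of_nonneg hs.1] at this
  have hq : ∀ s ∈ Icc 0 (dist p q), dist (j s) q = dist p q - s := fun s hs => by
    have := hj s hs _ hr
    rwa [h1, abs_sub_comm, abs_of_nonneg (by linarith [hs.2])] at this
  ext z
  constructor
  · rintro ⟨s, hs, rfl⟩
    rw [mem_ofPred_eq, hp s hs, hq s hs]; ring
  · intro hz
    have hs : dist p z ∈ Icc 0 (dist p q) :=
      ⟨dist_nonneg, by rw [mem_ofPred_eq] at hz; linarith [dist_nonneg (x := z) (y := q)]⟩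
    refine ⟨dist p z, hs, ?_⟩
    refine h.eq_of_between ?_ hz (hp _ hs)
    rw [hp _ hs, hq _ hs]; ring

lemma isGeodesicSegment_iff {p q : T} {S : Set T} :
    IsGeodesicSegment p q S ↔ S = {z | dist p z + dist z q = dist p q} := by
  constructor
  · rintro ⟨j, hj, h0, h1, rfl⟩
    exact h.image_path_eq hj h0 h1
  · rintro rfl
    obtain ⟨j, hj, h0, h1⟩ := h.exists_path p q
    exact ⟨j, hj, h0, h1, (h.image_path_eq hj h0 h1).symm⟩

/-- Any three points have a median. -/
lemma exists_median (x y z : T) : ∃ c, dist x c + dist c y = dist x y ∧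
    dist y c + dist c z = dist y z ∧ dist x c + dist c z = dist x z := by
  have m1 := h.join_le_max x y z
  have m2 := h.join_le_max y x z
  have m3 := h.join_le_max x z y
  rw [h.join_comm y x] at m2
  rw [h.join_comm z y] at m3
  -- The two larger of the three merging heights agree, so the median is the point where the pair
  -- with the lowest merging height meets.
  have key : ∀ a b c : T, h.join a b ≤ h.join a c → h.join a b ≤ h.join b c →
      dist a (h.up a (h.join a b)) + dist (h.up a (h.join a b)) b = dist a b ∧
      dist b (h.up a (h.join a b)) + dist (h.up a (h.join a b)) c = dist b c ∧
      dist a (h.up a (h.join a b)) + dist (h.up a (h.join a b)) c = dist a c := by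
    intro a b c h1 h2
    refine ⟨h.dist_up_add_left (h.le_join_left _ _) le_rfl, ?_,
      h.dist_up_add_left (h.le_join_left _ _) h1⟩
    rw [h.up_join]
    exact h.dist_up_add_left (h.le_join_right _ _) h2
  by_cases h1 : h.join x y ≤ h.join x z ∧ h.join x y ≤ h.join y z
  · exact ⟨_, key x y z h1.1 h1.2⟩
  by_cases h2 : h.join y z ≤ h.join x y ∧ h.join y z ≤ h.join x z
  · obtain ⟨k1, k2, k3⟩ := key y z x (by rw [h.join_comm y x]; exact h2.1)
      (by rw [h.join_comm z x]; exact h2.2)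
    refine ⟨_, ?_, k1, ?_⟩
    · rw [dist_comm x, dist_comm _ y, dist_comm x]; linarith
    · rw [dist_comm x, dist_comm _ z, dist_comm x]; linarith
  · have h3 : h.join x z ≤ h.join x y ∧ h.join x z ≤ h.join z y := by
      rw [h.join_comm z y]
      rw [not_and_or, not_le, not_le] at h1 h2
      rw [le_max_iff] at m1 m2 m3
      constructor <;> (rcases h1 with h1 | h1 <;> rcases h2 with h2 | h2 <;> grind)
    obtain ⟨k1, k2, k3⟩ := key x z y h3.1 h3.2
    refine ⟨_, k3, ?_, k1⟩
    rw [dist_comm y, dist_comm _ z, dist_comm y]; linarith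

theorem isRTree : IsRTree T where
  existsUnique_segment x y :=
    ⟨_, h.isGeodesicSegment_iff.2 rfl, fun _ hS => h.isGeodesicSegment_iff.1 hS⟩
  union_segment x y z S S' hS hS' hSS := by
    rw [h.isGeodesicSegment_iff] at hS hS' ⊢
    -- The median lies on both segments, hence equals `y`; so `y` is between `x` and `z`.
    obtain ⟨c, c1, c2, c3⟩ := h.exists_median x y z
    have hc : c ∈ S ∩ S' := by rw [hS, hS']; exact ⟨c1, c2⟩
    rw [hSS, mem_singleton_iff] at hc
    subst hc
    have hz := c3
    subst hS hS'
    ext w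
    constructor
    · rintro (hw | hw)
      · have := dist_triangle w c z
        have := dist_triangle x w z
        simp only [mem_ofPred_eq] at *; linarith
      · have := dist_triangle x c w
        have := dist_triangle x w z
        simp only [mem_ofPred_eq] at *; linarith
    · intro hw
      obtain ⟨j, hj, h0, h1⟩ := h.exists_path x z
      have hI := h.image_path_eq hj h0 h1
      obtain ⟨s, hs, rfl⟩ : w ∈ j '' Icc 0 (dist x z) := by rw [hI]; exact hw
      obtain ⟨t, ht, rfl⟩ : c ∈ j '' Icc 0 (dist x z) := by rw [hI]; exact hz
      have l0 : (0 : ℝ) ∈ Icc 0 (dist x z) := ⟨le_rfl, dist_nonneg⟩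
      have l1 : dist x z ∈ Icc 0 (dist x z) := ⟨dist_nonneg, le_rfl⟩
      have e1 := hj 0 l0 s hs
      have e2 := hj 0 l0 t ht
      have e3 := hj s hs _ l1
      have e4 := hj t ht _ l1
      rw [h0, zero_sub, abs_neg, abs_of_nonneg hs.1] at e1
      rw [h0, zero_sub, abs_neg, abs_of_nonneg ht.1] at e2
      rw [h1, abs_sub_comm, abs_of_nonneg (by linarith [hs.2])] at e3
      rw [h1, abs_sub_comm, abs_of_nonneg (by linarith [ht.2])] at e4
      have e5 := hj s hs t ht
      have e6 := dist_comm (j s) (j t)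
      rcases le_total s t with hst | hst
      · left
        rw [abs_sub_comm, abs_of_nonneg (by linarith)] at e5
        rw [mem_ofPred_eq]; linarith
      · right
        rw [abs_of_nonneg (by linarith)] at e5
        rw [mem_ofPred_eq]; linarith

end HeightTree

/-! ### Vertices of integral height and local finiteness. -/

namespace HeightTree

variable {T : Type*} [MetricSpace T] (h : HeightTree T)

/-- The graph on the points of integral height, in which every point is joined to the point one
unit above it. -/
def integralGraph : SimpleGraph {p : T | ∃ n : ℤ, h.height p = n} where
  Adj p q := (q : T) = h.up p (h.height p + 1) ∨ (p : T) = h.up q (h.height q + 1)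
  symm := ⟨fun _ _ e => e.symm⟩
  loopless := ⟨fun p e => by
    have : (p : T) = h.up p (h.height p + 1) := e.elim id id
    have := congrArg h.height this
    rw [h.height_up_of_le (by linarith)] at this
    linarith⟩

variable {h}

lemma dist_of_integralGraph_adj {p q : {p : T | ∃ n : ℤ, h.height p = n}}
    (hpq : h.integralGraph.Adj p q) : dist (p : T) q = 1 := by
  rcases hpq with e | e
  · rw [e, h.dist_up (by linarith)]; ring
  · rw [e, dist_comm, h.dist_up (by linarith)]; ring

lemma dist_le_length {p q : {p : T | ∃ n : ℤ, h.height p = n}} (w : h.integralGraph.Walk p q) :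
    dist (p : T) q ≤ w.length := by
  induction w with
  | nil => simp
  | @cons a b c hab _ ih =>
    have := dist_triangle (a : T) b c
    rw [dist_of_integralGraph_adj hab] at this
    rw [SimpleGraph.Walk.length_cons]
    push_cast
    linarith

lemma exists_walk_up (n : ℕ) (p q : {p : T | ∃ n : ℤ, h.height p = n})
    (hq : (q : T) = h.up p (h.height p + n)) :
    ∃ w : h.integralGraph.Walk p q, w.length = n := by
  induction n generalizing q with
  | zero =>
    have : p = q := Subtype.ext (by rw [hq]; simp [h.up_self])
    subst this
    exact ⟨.nil, rfl⟩
  | succ n ih =>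
    obtain ⟨m, hm⟩ := p.2
    have hn : h.height p ≤ h.height p + n := by simp
    let r : {p : T | ∃ n : ℤ, h.height p = n} :=
      ⟨h.up p (h.height p + n), m + n, by rw [h.height_up_of_le hn, hm]; push_cast; rfl⟩
    obtain ⟨w, hw⟩ := ih r rfl
    have hr : h.integralGraph.Adj r q := by
      left
      rw [hq]
      change _ = h.up (h.up p (h.height p + n)) (h.height (h.up p (h.height p + n)) + 1)
      rw [h.height_up_of_le hn, h.up_up_of_le _ (by linarith)]
      push_cast
      rw [add_assoc]
    refine ⟨w.concat hr, ?_⟩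
    rw [SimpleGraph.Walk.length_concat, hw]

/-- Climb from both vertices to their merging point, which is a vertex because `hJ` makes its height
integral. -/
lemma exists_walk (hJ : ∀ p q : T, (∃ n : ℤ, h.height p = n) → (∃ n : ℤ, h.height q = n) →
      ∃ n : ℤ, h.join p q = n) (p q : {p : T | ∃ n : ℤ, h.height p = n}) :
    ∃ w : h.integralGraph.Walk p q, (w.length : ℝ) = dist (p : T) q := by
  obtain ⟨k, hk⟩ := hJ p q p.2 q.2
  obtain ⟨m, hm⟩ := p.2
  obtain ⟨n, hn⟩ := q.2
  have h1 := h.le_join_left p q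
  have h2 := h.le_join_right p q
  have hmk : m ≤ k := by rw [hm, hk] at h1; exact_mod_cast h1
  have hnk : n ≤ k := by rw [hn, hk] at h2; exact_mod_cast h2
  let r : {p : T | ∃ n : ℤ, h.height p = n} :=
    ⟨h.up p (h.join p q), k, by rw [h.height_up_of_le h1, hk]⟩
  have c1 : (((k - m).toNat : ℕ) : ℝ) = k - m := by
    rw [← Int.cast_natCast, Int.toNat_of_nonneg (by linarith)]; push_cast; rfl
  have c2 : (((k - n).toNat : ℕ) : ℝ) = k - n := by
    rw [← Int.cast_natCast, Int.toNat_of_nonneg (by linarith)]; push_cast; rfl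
  obtain ⟨w1, e1⟩ := exists_walk_up (k - m).toNat p r (by
    change h.up p (h.join p q) = _
    congr 1; rw [c1, hk, hm]; ring)
  obtain ⟨w2, e2⟩ := exists_walk_up (k - n).toNat q r (by
    change h.up p (h.join p q) = _
    rw [h.up_join]
    congr 1; rw [c2, hk, hn]; ring)
  refine ⟨w1.append w2.reverse, ?_⟩
  rw [SimpleGraph.Walk.length_append, SimpleGraph.Walk.length_reverse, e1, e2, h.dist_eq]
  push_cast
  rw [c1, c2, hk, hm, hn]; ring

/-- An edge of the graph separates the points below it from the others. -/
lemma integralGraph_isAcyclic : h.integralGraph.IsAcyclic := by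
  rw [SimpleGraph.isAcyclic_iff_forall_adj_isBridge]
  have key : ∀ p q : {p : T | ∃ n : ℤ, h.height p = n}, (q : T) = h.up p (h.height p + 1) →
      ¬ (h.integralGraph \ SimpleGraph.fromEdgeSet {s(p, q)}).Reachable p q := by
    rintro p q e ⟨w⟩
    have hq : h.height q = h.height p + 1 := by rw [e, h.height_up_of_le (by linarith)]
    -- From a point below `p`, the only step that leaves the points below `p` is the removed edge
    -- from `p` to `q`.
    have inv : ∀ a b : {p : T | ∃ n : ℤ, h.height p = n},
        (h.integralGraph \ SimpleGraph.fromEdgeSet {s(p, q)}).Walk a b →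
        (h.height a ≤ h.height p ∧ h.up a (h.height p) = p) →
        (h.height b ≤ h.height p ∧ h.up b (h.height p) = p) := by
      intro a b w
      induction w with
      | nil => exact id
      | @cons a b c hab _ ih =>
        intro ha
        apply ih
        rw [SimpleGraph.sdiff_adj] at hab
        obtain ⟨hab, hne⟩ := hab
        obtain ⟨m, hm⟩ := a.2
        obtain ⟨n, hn⟩ := p.2
        rcases hab with e' | e'
        · by_cases hap : h.height a = h.height p
          · exfalso
            have hap' : a = p := Subtype.ext (by rw [← ha.2, ← hap, h.up_self])
            have hbq : b = q := Subtype.ext (by rw [e', e, hap'])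
            apply hne
            rw [SimpleGraph.fromEdgeSet_adj, hap', hbq]
            refine ⟨rfl, fun h' => ?_⟩
            rw [h'] at hq; linarith
          · have hlt : h.height a + 1 ≤ h.height p := by
              have := lt_of_le_of_ne ha.1 hap
              rw [hm, hn] at this ⊢
              exact_mod_cast this
            rw [e', h.height_up_of_le (by linarith), h.up_up_of_le _ hlt]
            exact ⟨hlt, ha.2⟩
        · have hba : h.height a = h.height b + 1 := by rw [e', h.height_up_of_le (by linarith)]
          refine ⟨by linarith [ha.1], ?_⟩
          rw [← h.up_up_of_le b (s := h.height b + 1) (by linarith [ha.1]), ← e', ha.2]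
    have := (inv p q w ⟨le_rfl, h.up_self _⟩).1
    linarith
  intro p q hpq
  rcases hpq with e | e
  · exact key p q e
  · intro hr
    rw [Sym2.eq_swap] at hr
    exact key q p e hr.symm

/-- A criterion for being a locally finite tree, with the points of integral height as
vertices. -/
theorem isLocallyFiniteTree [Nonempty T] (h : HeightTree T)
    (hJ : ∀ p q : T, (∃ n : ℤ, h.height p = n) → (∃ n : ℤ, h.height q = n) →
      ∃ n : ℤ, h.join p q = n)
    (hfloor : ∀ p : T, ∃ q, h.height q = ⌊h.height p⌋ ∧ h.up q (h.height p) = p)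
    (hfin : ∀ p : T, {q | h.height q + 1 = h.height p ∧ h.up q (h.height p) = p}.Finite) :
    IsLocallyFiniteTree T := by
  obtain ⟨p₀⟩ := ‹Nonempty T›
  have hconn : h.integralGraph.Connected := by
    have : Nonempty {p : T | ∃ n : ℤ, h.height p = n} := by
      obtain ⟨q, hq, -⟩ := hfloor p₀
      exact ⟨⟨q, _, hq⟩⟩
    exact ⟨fun p q => ⟨(exists_walk hJ p q).choose⟩⟩
  refine ⟨h.isRTree, {p : T | ∃ n : ℤ, h.height p = n}, h.integralGraph,
    ⟨hconn, integralGraph_isAcyclic⟩, ?_, ?_, ?_⟩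
  · intro v
    apply Finite.of_finite_image (f := Subtype.val) _ Subtype.val_injective.injOn
    apply ((hfin v).insert (h.up v (h.height v + 1))).subset
    rintro _ ⟨q, hq, rfl⟩
    rcases hq with e | e
    · exact Or.inl e
    · right
      have : h.height v = h.height q + 1 := by rw [e, h.height_up_of_le (by linarith)]
      exact ⟨this.symm, by rw [this, ← e]⟩
  · intro v w
    obtain ⟨p, hp⟩ := exists_walk hJ v w
    apply le_antisymm
    · obtain ⟨q, hq⟩ := hconn.exists_walk_length_eq_dist v w
      rw [← hq]
      exact dist_le_length q
    · rw [← hp]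
      exact_mod_cast SimpleGraph.dist_le p
  · intro x
    right
    obtain ⟨q, hq, hqx⟩ := hfloor x
    have hx : h.height q ≤ h.height x := by rw [hq]; exact Int.floor_le _
    have hx' : h.height x < h.height q + 1 := by rw [hq]; exact Int.lt_floor_add_one _
    have hq1 : h.height q ≤ h.height q + 1 := by linarith
    refine ⟨⟨q, _, hq⟩, ⟨h.up q (h.height q + 1), ⌊h.height x⌋ + 1, by
      rw [h.height_up_of_le hq1, hq]; push_cast; rfl⟩, _, Or.inl rfl,
      h.isGeodesicSegment_iff.2 rfl, ?_⟩
    have := h.dist_up_add_left (p := q) (q := h.up q (h.height q + 1)) hx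
      (by rw [h.join_up hq1]; exact hx'.le)
    rwa [hqx] at this

/-! ### Vertical segments and canonical retractions. -/

/-- The segment from a point to a point above it. -/
lemma isGeodesicSegment_up (h : HeightTree T) {p : T} {t : ℝ} (ht : h.height p ≤ t) :
    IsGeodesicSegment p (h.up p t)
      {z | h.height p ≤ h.height z ∧ h.height z ≤ t ∧ z = h.up p (h.height z)} := by
  rw [h.isGeodesicSegment_iff]
  ext z
  simp only [mem_ofPred_eq]
  constructor
  · rintro ⟨h1, h2, h3⟩
    have := h.dist_up_add_left (q := h.up p t) h1 (by rwa [h.join_up ht])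
    rwa [← h3] at this
  · intro hz
    rcases h.eq_up_of_between hz with ⟨e, h1, h2⟩ | ⟨e, h1, h2⟩
    · rw [h.join_up ht] at h2
      exact ⟨h1, h2, e⟩
    · rw [h.join_up ht] at h2
      rw [h.height_up_of_le ht] at h1
      have h3 := le_antisymm h2 h1
      refine ⟨ht.trans h1, h2, ?_⟩
      rw [e, h.height_up_of_le (by rw [h.height_up_of_le ht]; exact h1), h3,
        h.up_up_of_le p le_rfl]

lemma continuousOn_up (h : HeightTree T) (p : T) : ContinuousOn (h.up p) (Ici (h.height p)) := by
  rw [Metric.continuousOn_iff]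
  intro t ht ε hε
  refine ⟨ε, hε, fun s hs hst => ?_⟩
  rwa [h.dist_up_up hs ht, ← Real.dist_eq]

lemma dist_eq_height_sub {p q : T} (hq : h.height p ≤ h.height q)
    (e : h.up p (h.height q) = q) : dist p q = h.height q - h.height p := by
  have := h.dist_up hq
  rwa [e] at this

/-- The canonical retraction onto a subtree that is closed under going up maps a point to the
first point above it that lies in the subtree. -/
theorem canonicalRetract (h : HeightTree T) {A : Set T} (hA : ∀ p ∈ A, ∀ t, h.up p t ∈ A) {x : T}
    {t : ℝ} (hx : h.height x ≤ t) (hy : h.up x t ∈ A)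
    (hlt : ∀ s, h.height x ≤ s → s < t → h.up x s ∉ A) :
    CanonicalRetract A x (h.up x t) := by
  set y := h.up x t with hydef
  have hyt : h.height y = t := h.height_up_of_le hx
  rcases hx.eq_or_lt with hxt | hxt
  · left
    have : y = x := by rw [hydef, ← hxt, h.up_self]
    exact ⟨this ▸ hy, this⟩
  right
  refine ⟨by simpa [h.up_self] using hlt (h.height x) le_rfl hxt, ?_⟩
  -- The component of `x` consists of the points whose rays meet that of `x` strictly below `y`.
  -- This set is connected through the merging points, it is open, and its closure adds only `y`.
  set C : Set T := {p | h.join p x < t} with hC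
  have hxC : x ∈ C := by rw [hC, mem_ofPred_eq, h.join_self]; exact hxt
  have hCA : C ⊆ Aᶜ := by
    intro p hp hpA
    refine hlt (h.join p x) (h.le_join_right _ _) hp ?_
    rw [← h.up_join]
    exact hA p hpA _
  -- points above `x` and below `t`
  have hupC : ∀ p ∈ C, ∀ s, h.height p ≤ s → s ≤ h.join p x → h.up p s ∈ C := by
    intro p hp s hs hs'
    refine lt_of_le_of_lt (h.join_le (t := h.join p x) ?_ (h.le_join_right _ _) ?_) hp
    · rwa [h.height_up_of_le hs]
    · rw [h.up_up_of_le _ hs', h.up_join]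
  have hconn : IsPreconnected C := by
    refine isPreconnected_of_forall x fun p hp => ?_
    have i1 : IsPreconnected (h.up p '' Icc (h.height p) (h.join p x)) :=
      isPreconnected_Icc.image _ ((h.continuousOn_up p).mono Icc_subset_Ici_self)
    have i2 : IsPreconnected (h.up x '' Icc (h.height x) (h.join p x)) :=
      isPreconnected_Icc.image _ ((h.continuousOn_up x).mono Icc_subset_Ici_self)
    refine ⟨h.up p '' Icc (h.height p) (h.join p x) ∪ h.up x '' Icc (h.height x) (h.join p x),
      ?_, Or.inr ⟨_, ⟨le_rfl, h.le_join_right _ _⟩, h.up_self x⟩,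
      Or.inl ⟨_, ⟨le_rfl, h.le_join_left _ _⟩, h.up_self p⟩, ?_⟩
    · rintro _ (⟨s, hs, rfl⟩ | ⟨s, hs, rfl⟩)
      · exact hupC p hp s hs.1 hs.2
      · refine lt_of_le_of_lt (h.join_le (t := h.join p x) ?_ (h.le_join_right _ _) ?_) hp
        · rw [h.height_up_of_le hs.1]; exact hs.2
        · rw [h.up_up_of_le _ hs.2]
    · exact i1.union (h.up p (h.join p x)) ⟨_, ⟨h.le_join_left _ _, le_rfl⟩, rfl⟩
        ⟨_, ⟨h.le_join_right _ _, le_rfl⟩, (h.up_join p x).symm⟩ i2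
  have hyC : ∀ p ∈ C, h.height p < t ∧ h.up p t = y := fun p hp =>
    ⟨(h.le_join_left p x).trans_lt hp, h.up_eq_up (le_of_lt hp)⟩
  have hdist : ∀ p ∈ C, ∀ q, dist p q < dist p y → q ∈ C := by
    intro p hp q hpq
    obtain ⟨h1, h2⟩ := hyC p hp
    rw [h.dist_eq_height_sub (q := y) (by rw [hyt]; exact h1.le) (by rw [hyt]; exact h2), hyt,
      h.dist_eq] at hpq
    have h3 := h.le_join_right p q
    have h4 := h.join_le_max q p x
    rw [h.join_comm q p] at h4
    exact lt_of_le_of_lt h4 (max_lt (by linarith) hp)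
  have hfar : ∀ p ∈ C, ∀ q, q ∉ C → dist y q ≤ dist p q := by
    intro p hp q hq
    obtain ⟨h1, h2⟩ := hyC p hp
    have h3 : t ≤ h.join p q := by
      by_contra h3
      have h4 := h.join_le_max q p x
      rw [h.join_comm q p] at h4
      exact hq (lt_of_le_of_lt h4 (max_lt (not_le.1 h3) hp))
    have := h.dist_up_add_left (q := q) h1.le h3
    rw [h2] at this
    linarith [dist_nonneg (x := p) (y := y)]
  have hopen : IsOpen C := by
    rw [Metric.isOpen_iff]
    intro p hp
    have : p ≠ y := fun e => by
      have h1 := (hyC p hp).1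
      rw [e, hyt] at h1
      exact lt_irrefl _ h1
    refine ⟨dist p y, dist_pos.2 this, fun q hq => hdist p hp q ?_⟩
    rwa [dist_comm]
  have hclosure : closure C ⊆ insert y C := by
    intro q hq
    by_contra hqn
    rw [mem_insert_iff, not_or] at hqn
    obtain ⟨p, hp, hpq⟩ := Metric.mem_closure_iff.1 hq (dist y q) (dist_pos.2 (Ne.symm hqn.1))
    rw [dist_comm] at hpq
    exact absurd (hfar p hp q hqn.2) (not_le.2 hpq)
  have hcomp : connectedComponentIn Aᶜ x = C := by
    apply Subset.antisymm
    · have hpre := isPreconnected_connectedComponentIn (F := Aᶜ) (x := x)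
      have hsub : connectedComponentIn Aᶜ x ⊆ C ∪ (closure C)ᶜ := by
        intro q hq
        have hqA := connectedComponentIn_subset _ _ hq
        by_cases hqC : q ∈ closure C
        · rcases hclosure hqC with e | hqC
          · exact absurd hy (e ▸ hqA)
          · exact Or.inl hqC
        · exact Or.inr hqC
      refine hpre.subset_left_of_subset_union hopen isClosed_closure.isOpen_compl ?_ hsub ?_
      · exact disjoint_compl_right.mono_left subset_closure
      · exact ⟨x, mem_connectedComponentIn (hCA hxC), hxC⟩
    · exact hconn.subset_connectedComponentIn hxC hCA
  rw [hcomp, hopen.frontier_eq]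
  apply Subset.antisymm
  · rintro q ⟨hq, hqC⟩
    rcases hclosure hq with e | hq
    · exact e
    · exact absurd hq hqC
  · rintro _ rfl
    refine ⟨Metric.mem_closure_iff.2 fun ε hε => ?_, fun hyC => hCA hyC hy⟩
    have hs : h.height x ≤ max (h.height x) (t - ε / 2) := le_max_left _ _
    have hs' : max (h.height x) (t - ε / 2) < t := max_lt hxt (by linarith)
    refine ⟨h.up x (max (h.height x) (t - ε / 2)), ?_, ?_⟩
    · rw [hC, mem_ofPred_eq, h.join_comm, h.join_up hs]; exact hs'
    · rw [hydef, h.dist_up_up hx hs, abs_of_nonneg (by linarith)]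
      linarith [le_max_right (h.height x) (t - ε / 2)]

end HeightTree

/-! ### Trees glued from edges of length `2 ^ k` -/

/-- Combinatorial data for a tree without root: an edge `e` of level `k` is a vertical segment
of length `2 ^ k` with lower end at height `base e`, and its upper end is glued to the edge
`par e`, which has a higher level, at the distance `off e` from the lower end of `par e`. -/
structure EdgeTree (E : Type*) where
  lev : E → ℕ
  par : E → E
  off : E → ℕ
  base : E → ℤ
  lev_lt : ∀ e, lev e < lev (par e)
  off_lt : ∀ e, off e < 2 ^ lev (par e)
  dvd_off : ∀ e, 2 ^ lev e ∣ off e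
  base_par : ∀ e, base (par e) + off e = base e + 2 ^ lev e
  directed : ∀ e e', ∃ m n, par^[m] e = par^[n] e'
  finite_children : ∀ e, {c | par c = e}.Finite

namespace EdgeTree

variable {E : Type*} (𝓔 : EdgeTree E)

/-- The height of the upper end of an edge. -/
def top (e : E) : ℤ := 𝓔.base e + 2 ^ 𝓔.lev e

lemma base_lt_top (e : E) : 𝓔.base e < 𝓔.top e := by
  unfold top; linarith [pow_pos (zero_lt_two (α := ℤ)) (𝓔.lev e)]

lemma base_par_le (e : E) : 𝓔.base (𝓔.par e) ≤ 𝓔.top e := by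
  have := 𝓔.base_par e
  unfold top; linarith [Int.natCast_nonneg (𝓔.off e)]

lemma top_lt_top_par (e : E) : 𝓔.top e < 𝓔.top (𝓔.par e) := by
  have h1 := 𝓔.base_par e
  have h2 : (𝓔.off e : ℤ) < 2 ^ 𝓔.lev (𝓔.par e) := by exact_mod_cast 𝓔.off_lt e
  unfold top; linarith

lemma top_add_le (e : E) (n : ℕ) : 𝓔.top e + n ≤ 𝓔.top (𝓔.par^[n] e) := by
  induction n with
  | zero => simp
  | succ n ih =>
    rw [Function.iterate_succ_apply']
    have := 𝓔.top_lt_top_par (𝓔.par^[n] e)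
    push_cast
    linarith

lemma lev_add_le (e : E) (n : ℕ) : 𝓔.lev e + n ≤ 𝓔.lev (𝓔.par^[n] e) := by
  induction n with
  | zero => simp
  | succ n ih =>
    rw [Function.iterate_succ_apply']
    have := 𝓔.lev_lt (𝓔.par^[n] e)
    omega

lemma exists_lt_top (e : E) (t : ℝ) : ∃ n, t < 𝓔.top (𝓔.par^[n] e) := by
  obtain ⟨n, hn⟩ := exists_nat_gt (t - 𝓔.top e)
  refine ⟨n, ?_⟩
  have : ((𝓔.top e + n : ℤ) : ℝ) ≤ 𝓔.top (𝓔.par^[n] e) := by exact_mod_cast 𝓔.top_add_le e n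
  push_cast at this
  linarith

open Classical in
/-- The edge which the upward ray from (a point of) the edge `e` traverses at height `t`. -/
noncomputable def edgeAt (e : E) (t : ℝ) : E := 𝓔.par^[Nat.find (𝓔.exists_lt_top e t)] e

lemma edgeAt_of_lt {e : E} {t : ℝ} (ht : t < 𝓔.top e) : 𝓔.edgeAt e t = e := by
  classical
  rw [edgeAt, (Nat.find_eq_zero (𝓔.exists_lt_top e t)).2 (by simpa using ht)]
  rfl

lemma edgeAt_of_le {e : E} {t : ℝ} (ht : 𝓔.top e ≤ t) :
    𝓔.edgeAt e t = 𝓔.edgeAt (𝓔.par e) t := by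
  classical
  unfold edgeAt
  rw [Nat.find_comp_succ (𝓔.exists_lt_top e t) (𝓔.exists_lt_top (𝓔.par e) t)
    (by simpa using ht), Function.iterate_succ_apply]
  rfl

lemma lt_top_edgeAt (e : E) (t : ℝ) : t < 𝓔.top (𝓔.edgeAt e t) := by
  classical
  exact Nat.find_spec (𝓔.exists_lt_top e t)

lemma exists_edgeAt_eq (e : E) (t : ℝ) : ∃ n, 𝓔.edgeAt e t = 𝓔.par^[n] e := ⟨_, rfl⟩

/-- Induction on the number of edges that an upward ray traverses below the height `t`. -/
lemma ray_induction {P : E → Prop} (t : ℝ) (h0 : ∀ e, t < 𝓔.top e → P e)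
    (h1 : ∀ e, 𝓔.top e ≤ t → P (𝓔.par e) → P e) (e : E) : P e := by
  obtain ⟨n, hn⟩ := 𝓔.exists_lt_top e t
  induction n generalizing e with
  | zero => exact h0 e hn
  | succ n ih =>
    rcases lt_or_ge t (𝓔.top e) with h | h
    · exact h0 e h
    · exact h1 e h (ih _ (by rwa [Function.iterate_succ_apply] at hn))

lemma cast_base_par_le (e : E) : (𝓔.base (𝓔.par e) : ℝ) ≤ 𝓔.top e := by
  exact_mod_cast 𝓔.base_par_le e

lemma base_edgeAt_le {e : E} {t : ℝ} (ht : 𝓔.base e ≤ t) : 𝓔.base (𝓔.edgeAt e t) ≤ t := by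
  induction e using 𝓔.ray_induction t with
  | h0 e h => rwa [𝓔.edgeAt_of_lt h]
  | h1 e h ih =>
    rw [𝓔.edgeAt_of_le h]
    exact ih ((𝓔.cast_base_par_le e).trans h)

lemma edgeAt_edgeAt (e : E) {s t : ℝ} (hst : s ≤ t) :
    𝓔.edgeAt (𝓔.edgeAt e s) t = 𝓔.edgeAt e t := by
  induction e using 𝓔.ray_induction s with
  | h0 e h => rw [𝓔.edgeAt_of_lt h]
  | h1 e h ih => rw [𝓔.edgeAt_of_le h, ih, 𝓔.edgeAt_of_le (h.trans hst)]

/-- Edges end at integral heights, so rays change edges only there. Hence it suffices to look for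
merging heights among the integers, as `joinBase` does. -/
lemma edgeAt_floor (e : E) (t : ℝ) : 𝓔.edgeAt e ((⌊t⌋ : ℤ) : ℝ) = 𝓔.edgeAt e t := by
  induction e using 𝓔.ray_induction t with
  | h0 e h =>
    rw [𝓔.edgeAt_of_lt h, 𝓔.edgeAt_of_lt (lt_of_le_of_lt (Int.floor_le t) h)]
  | h1 e h ih =>
    rw [𝓔.edgeAt_of_le h, 𝓔.edgeAt_of_le (by exact_mod_cast Int.le_floor.2 h), ih]

lemma edgeAt_iterate (e : E) (n : ℕ) {t : ℝ} (ht : 𝓔.top (𝓔.par^[n] e) ≤ t) :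
    𝓔.edgeAt e t = 𝓔.edgeAt (𝓔.par^[n] e) t := by
  induction n generalizing e with
  | zero => rfl
  | succ n ih =>
    rw [Function.iterate_succ_apply] at ht ⊢
    rw [← ih _ ht, 𝓔.edgeAt_of_le]
    have h1 := 𝓔.top_add_le (𝓔.par e) n
    have h2 := 𝓔.top_lt_top_par e
    have h3 : (𝓔.top e : ℝ) ≤ 𝓔.top (𝓔.par^[n] (𝓔.par e)) := by exact_mod_cast by omega
    exact h3.trans ht

lemma exists_edgeAt_eq_edgeAt (e e' : E) :
    ∃ n : ℤ, 𝓔.base e ≤ n ∧ 𝓔.base e' ≤ n ∧ 𝓔.edgeAt e n = 𝓔.edgeAt e' n := by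
  obtain ⟨m, n, h⟩ := 𝓔.directed e e'
  refine ⟨max (max (𝓔.base e) (𝓔.base e')) (𝓔.top (𝓔.par^[m] e)),
    (le_max_left _ _).trans (le_max_left _ _), (le_max_right _ _).trans (le_max_left _ _), ?_⟩
  rw [𝓔.edgeAt_iterate e m, 𝓔.edgeAt_iterate e' n, h]
  · rw [← h]; exact_mod_cast le_max_right _ _
  · exact_mod_cast le_max_right _ _

/-- The height at which the upward rays from the lower ends of two edges merge. -/
noncomputable def joinBase (e e' : E) : ℤ :=
  sInf {n : ℤ | 𝓔.base e ≤ n ∧ 𝓔.base e' ≤ n ∧ 𝓔.edgeAt e n = 𝓔.edgeAt e' n}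

lemma joinBase_mem (e e' : E) : 𝓔.base e ≤ 𝓔.joinBase e e' ∧ 𝓔.base e' ≤ 𝓔.joinBase e e' ∧
    𝓔.edgeAt e (𝓔.joinBase e e') = 𝓔.edgeAt e' (𝓔.joinBase e e') :=
  Int.csInf_mem (s := {n : ℤ | 𝓔.base e ≤ n ∧ 𝓔.base e' ≤ n ∧ 𝓔.edgeAt e n = 𝓔.edgeAt e' n})
    (𝓔.exists_edgeAt_eq_edgeAt e e') ⟨𝓔.base e, fun _ h => h.1⟩

lemma edgeAt_eq_edgeAt_iff {e e' : E} {t : ℝ} (h : 𝓔.base e ≤ t) (h' : 𝓔.base e' ≤ t) :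
    𝓔.edgeAt e t = 𝓔.edgeAt e' t ↔ 𝓔.joinBase e e' ≤ t := by
  constructor
  · intro he
    rw [← 𝓔.edgeAt_floor e, ← 𝓔.edgeAt_floor e'] at he
    have : 𝓔.joinBase e e' ≤ ⌊t⌋ :=
      csInf_le ⟨𝓔.base e, fun _ h => h.1⟩ ⟨Int.le_floor.2 h, Int.le_floor.2 h', he⟩
    exact Int.le_floor.1 this
  · intro ht
    rw [← 𝓔.edgeAt_edgeAt e ht, ← 𝓔.edgeAt_edgeAt e' ht, (𝓔.joinBase_mem e e').2.2]

/-- The points of the tree. -/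
@[ext] structure Point where
  edge : E
  ht : ℝ
  base_le : 𝓔.base edge ≤ ht
  lt_top : ht < 𝓔.top edge

namespace Point

variable {𝓔}

noncomputable def up (p : 𝓔.Point) (t : ℝ) : 𝓔.Point where
  edge := 𝓔.edgeAt p.edge (max p.ht t)
  ht := max p.ht t
  base_le := 𝓔.base_edgeAt_le (p.base_le.trans (le_max_left _ _))
  lt_top := 𝓔.lt_top_edgeAt _ _

/-- From its own height on, the ray of a point agrees with the ray of the lower end of its edge. -/
noncomputable def join (p q : 𝓔.Point) : ℝ := max (max p.ht q.ht) (𝓔.joinBase p.edge q.edge)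

end Point

/-- The tree structure on the set of points. -/
noncomputable def heightData : HeightData 𝓔.Point where
  height := Point.ht
  up := Point.up
  join := Point.join
  height_up _ _ := rfl
  up_of_le p t ht := by
    have : max p.ht t = p.ht := max_eq_left ht
    ext
    · change 𝓔.edgeAt p.edge (max p.ht t) = p.edge
      rw [this, 𝓔.edgeAt_of_lt p.lt_top]
    · exact this
  up_up p s t := by
    ext
    · change 𝓔.edgeAt (𝓔.edgeAt p.edge (max p.ht s)) (max (max p.ht s) t) =
        𝓔.edgeAt p.edge (max p.ht (max s t))
      rw [𝓔.edgeAt_edgeAt _ (le_max_left _ _), max_assoc]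
    · exact max_assoc _ _ _
  le_join_left p q := (le_max_left _ _).trans (le_max_left _ _)
  le_join_right p q := (le_max_right _ _).trans (le_max_left _ _)
  up_eq_up_iff p q t hp hq := by
    rw [Point.ext_iff]
    change 𝓔.edgeAt p.edge (max p.ht t) = 𝓔.edgeAt q.edge (max q.ht t) ∧
      max p.ht t = max q.ht t ↔ max (max p.ht q.ht) _ ≤ t
    rw [max_eq_right hp, max_eq_right hq,
      𝓔.edgeAt_eq_edgeAt_iff (p.base_le.trans hp) (q.base_le.trans hq)]
    simp [hp, hq]

noncomputable instance : MetricSpace 𝓔.Point := 𝓔.heightData.metricSpace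

noncomputable def heightTree : HeightTree 𝓔.Point where
  toHeightData := 𝓔.heightData
  dist_eq _ _ := rfl

lemma edge_up (p : 𝓔.Point) (t : ℝ) :
    (𝓔.heightTree.up p t).edge = 𝓔.edgeAt p.edge (max p.ht t) := rfl

lemma height_def (p : 𝓔.Point) : 𝓔.heightTree.height p = p.ht := rfl

lemma ht_up {p : 𝓔.Point} {t : ℝ} (ht : p.ht ≤ t) : (𝓔.heightTree.up p t).ht = t :=
  𝓔.heightTree.height_up_of_le ht

/-- The lower end of an edge. -/
def bot (e : E) : 𝓔.Point where
  edge := e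
  ht := 𝓔.base e
  base_le := le_rfl
  lt_top := by exact_mod_cast 𝓔.base_lt_top e

/-- Rays stay on an edge up to its upper end. -/
lemma edge_up_of_lt {p : 𝓔.Point} {t : ℝ} (ht : p.ht ≤ t) (ht' : t < 𝓔.top p.edge) :
    (𝓔.heightTree.up p t).edge = p.edge := by
  rw [edge_up, max_eq_right ht, 𝓔.edgeAt_of_lt ht']

lemma up_of_edge_eq {p q : 𝓔.Point} (he : p.edge = q.edge) (hpq : p.ht ≤ q.ht) :
    𝓔.heightTree.up p q.ht = q := by
  ext
  · rw [𝓔.edge_up_of_lt hpq (he ▸ q.lt_top), he]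
  · exact 𝓔.ht_up hpq

lemma edge_up_top (e : E) {p : 𝓔.Point} (hp : p.edge = e) :
    (𝓔.heightTree.up p (𝓔.top e)).edge = 𝓔.par e := by
  subst hp
  rw [edge_up, max_eq_right p.lt_top.le, 𝓔.edgeAt_of_le le_rfl, 𝓔.edgeAt_of_lt]
  exact_mod_cast 𝓔.top_lt_top_par _

lemma dist_of_edge_eq {p q : 𝓔.Point} (he : p.edge = q.edge) : dist p q = |p.ht - q.ht| := by
  wlog hpq : p.ht ≤ q.ht generalizing p q
  · rw [dist_comm, this he.symm (le_of_not_ge hpq), abs_sub_comm]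
  · rw [𝓔.heightTree.dist_eq_height_sub hpq (𝓔.up_of_edge_eq he hpq), abs_sub_comm,
      height_def, height_def, abs_of_nonneg (by linarith)]

/-- The subtree of the edges of level at least `k`. -/
def levelSet (k : ℕ) : Set 𝓔.Point := {p | k ≤ 𝓔.lev p.edge}

lemma le_lev_edgeAt (e : E) (t : ℝ) : 𝓔.lev e ≤ 𝓔.lev (𝓔.edgeAt e t) := by
  obtain ⟨n, hn⟩ := 𝓔.exists_edgeAt_eq e t
  rw [hn]
  linarith [𝓔.lev_add_le e n]

lemma up_mem_levelSet {k : ℕ} (p : 𝓔.Point) (hp : p ∈ 𝓔.levelSet k) (t : ℝ) :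
    𝓔.heightTree.up p t ∈ 𝓔.levelSet k :=
  le_trans hp (𝓔.le_lev_edgeAt _ _)

/-- The structure of the subtree of the edges of level at least `k`. -/
noncomputable def levelTree (k : ℕ) : HeightTree (𝓔.levelSet k) :=
  𝓔.heightTree.restrict (𝓔.levelSet k) fun p hp t => 𝓔.up_mem_levelSet p hp t

lemma coe_levelTree_up (k : ℕ) (p : 𝓔.levelSet k) (t : ℝ) :
    (((𝓔.levelTree k).up p t : 𝓔.levelSet k) : 𝓔.Point) = 𝓔.heightTree.up p t := rfl

lemma levelTree_height (k : ℕ) (p : 𝓔.levelSet k) :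
    (𝓔.levelTree k).height p = (p : 𝓔.Point).ht := rfl

theorem isLocallyFiniteTree [Nonempty E] : IsLocallyFiniteTree 𝓔.Point := by
  obtain ⟨e₀⟩ := ‹Nonempty E›
  have : Nonempty 𝓔.Point := ⟨𝓔.bot e₀⟩
  refine 𝓔.heightTree.isLocallyFiniteTree ?_ ?_ ?_
  · rintro p q ⟨m, hm⟩ ⟨n, hn⟩
    rw [height_def] at hm hn
    refine ⟨max (max m n) (𝓔.joinBase p.edge q.edge), ?_⟩
    change max (max p.ht q.ht) _ = _
    rw [hm, hn]
    push_cast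
    rfl
  · intro p
    have hb : (𝓔.base p.edge : ℝ) ≤ (⌊p.ht⌋ : ℤ) := by exact_mod_cast Int.le_floor.2 p.base_le
    refine ⟨⟨p.edge, ⌊p.ht⌋, hb, (Int.floor_le _).trans_lt p.lt_top⟩, rfl, ?_⟩
    exact 𝓔.up_of_edge_eq (q := p) rfl (Int.floor_le _)
  · intro p
    -- The tops of successive edges differ by at least `1`, so a point one unit below `p` is on the
    -- edge of `p` or on one glued to it, and each edge has at most one such point.
    have hfin : (insert p.edge {c | 𝓔.par c = p.edge}).Finite :=
      (𝓔.finite_children p.edge).insert _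
    refine Finite.of_finite_image (f := Point.edge) (hfin.subset ?_) ?_
    · rintro _ ⟨q, ⟨hq, hqp⟩, rfl⟩
      rw [height_def, height_def] at hq
      have hle : q.ht ≤ p.ht := by linarith
      have he : p.edge = 𝓔.edgeAt q.edge p.ht := by
        have := congrArg Point.edge hqp
        rwa [edge_up, height_def, max_eq_right hle, eq_comm] at this
      rcases lt_or_ge p.ht (𝓔.top q.edge) with h | h
      · left; rw [he, 𝓔.edgeAt_of_lt h]
      · right
        rw [mem_ofPred_eq, he, 𝓔.edgeAt_of_le h, 𝓔.edgeAt_of_lt]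
        have h1 : (𝓔.top q.edge : ℝ) + 1 ≤ 𝓔.top (𝓔.par q.edge) := by
          exact_mod_cast 𝓔.top_lt_top_par _
        linarith [q.lt_top]
    · rintro q ⟨hq, -⟩ q' ⟨hq', -⟩ he
      ext
      · exact he
      · rw [height_def, height_def] at hq hq'; linarith

end EdgeTree

/-! ### Convexity of free segments. -/

namespace HeightTree

variable {T : Type*} [MetricSpace T]

/-- The distance of two points of a segment, measured along the segment. -/
lemma dist_eq_of_between (h : HeightTree T) {x y p q : T} (hp : dist x p + dist p y = dist x y)
    (hq : dist x q + dist q y = dist x y) : dist p q = |dist x p - dist x q| := by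
  obtain ⟨j, hj, h0, h1⟩ := h.exists_path x y
  have hI := h.image_path_eq hj h0 h1
  obtain ⟨s, hs, rfl⟩ : p ∈ j '' Icc 0 (dist x y) := by rw [hI]; exact hp
  obtain ⟨t, ht, rfl⟩ : q ∈ j '' Icc 0 (dist x y) := by rw [hI]; exact hq
  have l0 : (0 : ℝ) ∈ Icc 0 (dist x y) := ⟨le_rfl, dist_nonneg⟩
  have e1 := hj 0 l0 s hs
  have e2 := hj 0 l0 t ht
  rw [h0, zero_sub, abs_neg, abs_of_nonneg hs.1] at e1
  rw [h0, zero_sub, abs_neg, abs_of_nonneg ht.1] at e2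
  rw [hj s hs t ht, e1, e2]

/-- Besides the convexity of a segment, this records that its end points are not inner points of a
smaller segment; hence open and half-open segments are convex too. -/
lemma between_trans (h : HeightTree T) {x y p q z : T} (hp : dist x p + dist p y = dist x y)
    (hq : dist x q + dist q y = dist x y) (hz : dist p z + dist z q = dist p q) :
    dist x z + dist z y = dist x y ∧ (z = x → p = x ∨ q = x) ∧ (z = y → p = y ∨ q = y) := by
  wlog hpq : dist x p ≤ dist x q generalizing p q
  · have := this hq hp (by rw [dist_comm q z, dist_comm z p, dist_comm q p]; linarith)
      (le_of_not_ge hpq)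
    rwa [or_comm, or_comm (a := p = y)]
  have h1 := h.dist_eq_of_between hp hq
  rw [abs_sub_comm, abs_of_nonneg (by linarith)] at h1
  have h2 := dist_triangle x p z
  have h3 := dist_triangle z q y
  have h4 := dist_triangle x z y
  refine ⟨by linarith, ?_, ?_⟩
  · rintro rfl
    left
    rw [dist_self] at *
    exact (dist_le_zero.1 (by linarith [dist_nonneg (x := p) (y := z)])).symm
  · rintro rfl
    right
    rw [dist_self] at *
    exact dist_le_zero.1 (by linarith [dist_nonneg (x := q) (y := z), dist_nonneg (x := z) (y := q)])

/-- A free segment is contained in a segment and convex. -/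
lemma exists_of_isFreeSegment (h : HeightTree T) {S : Set T} (hS : IsFreeSegment S) :
    (∃ x y, S ⊆ {z | dist x z + dist z y = dist x y}) ∧
    ∀ p ∈ S, ∀ q ∈ S, ∀ z, dist p z + dist z q = dist p q → z ∈ S := by
  rcases hS.1 with ⟨x, y, S', -, hS', rfl⟩ | ⟨x, y, S', -, hS', rfl⟩
  · rw [h.isGeodesicSegment_iff] at hS'
    subst hS'
    refine ⟨⟨x, y, sdiff_subset⟩, fun p hp q hq z hz => ?_⟩
    obtain ⟨h1, -, h3⟩ := h.between_trans hp.1 hq.1 hz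
    exact ⟨h1, fun e => (h3 e).elim hp.2 hq.2⟩
  · rw [h.isGeodesicSegment_iff] at hS'
    subst hS'
    refine ⟨⟨x, y, sdiff_subset⟩, fun p hp q hq z hz => ?_⟩
    obtain ⟨h1, h2, h3⟩ := h.between_trans hp.1 hq.1 hz
    refine ⟨h1, ?_⟩
    rintro (e | e)
    · exact (h2 e).elim (fun e => hp.2 (Or.inl e)) (fun e => hq.2 (Or.inl e))
    · exact (h3 e).elim (fun e => hp.2 (Or.inr e)) (fun e => hq.2 (Or.inr e))

/-- A free segment contains no centre of a tripod. -/
lemma not_tripod (h : HeightTree T) {S : Set T} (hS : IsFreeSegment S) {a b c : T} {δ : ℝ}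
    (hδ : 0 < δ) (ha : a ∈ S) (hb : b ∈ S) (hc : c ∈ S) (hab : dist a b = δ)
    (hac : dist a c = δ) (hbc : dist b c = δ) : False := by
  obtain ⟨⟨x, y, hxy⟩, -⟩ := h.exists_of_isFreeSegment hS
  have h1 := h.dist_eq_of_between (hxy ha) (hxy hb)
  have h2 := h.dist_eq_of_between (hxy ha) (hxy hc)
  have h3 := h.dist_eq_of_between (hxy hb) (hxy hc)
  rw [hab] at h1
  rw [hac] at h2
  rw [hbc] at h3
  rcases abs_cases (dist x a - dist x b) with h4 | h4 <;>
  rcases abs_cases (dist x a - dist x c) with h5 | h5 <;>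
  rcases abs_cases (dist x b - dist x c) with h6 | h6 <;> linarith

end HeightTree

/-! ### Branch points, maximal free segments and binary regularity. -/

namespace EdgeTree

variable {E : Type*} (𝓔 : EdgeTree E)

/-- All edges with children are in `R`, and to every edge in `R` there are glued at least two edges
of every smaller level `l` at all distances from the lower end that are divisible by `2 ^ l`. -/
structure IsBranched (R : E → Prop) : Prop where
  par_mem : ∀ e, R (𝓔.par e)
  exists_twins : ∀ e, R e → ∀ l q, l < 𝓔.lev e → q * 2 ^ l < 2 ^ 𝓔.lev e → ∃ c c', c ≠ c' ∧
    (𝓔.lev c = l ∧ 𝓔.par c = e ∧ 𝓔.off c = q * 2 ^ l) ∧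
    (𝓔.lev c' = l ∧ 𝓔.par c' = e ∧ 𝓔.off c' = q * 2 ^ l)

/-- The branch points of the subtree of level `k`. -/
def IsNode (R : E → Prop) (k : ℕ) (p : 𝓔.Point) : Prop :=
  R p.edge ∧ k < 𝓔.lev p.edge ∧ ∃ q : ℕ, p.ht = 𝓔.base p.edge + q * 2 ^ k

/-- In the second case `c` is the last edge that the ray leaves; its upper end is where the ray
enters its current edge. -/
lemma edgeAt_eq_or (e : E) (t : ℝ) : 𝓔.edgeAt e t = e ∨
    ∃ c, 𝓔.par c = 𝓔.edgeAt e t ∧ 𝓔.lev e ≤ 𝓔.lev c ∧ 𝓔.top e ≤ 𝓔.top c ∧ 𝓔.top c ≤ t := by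
  induction e using 𝓔.ray_induction t with
  | h0 e h => exact Or.inl (𝓔.edgeAt_of_lt h)
  | h1 e h ih =>
    right
    rw [𝓔.edgeAt_of_le h]
    rcases ih with ih | ⟨c, h1, h2, h3, h4⟩
    · exact ⟨e, ih.symm, le_rfl, le_rfl, h⟩
    · exact ⟨c, h1, (𝓔.lev_lt e).le.trans h2, (𝓔.top_lt_top_par e).le.trans h3, h4⟩

/-- A point close to `p` is on the same edge, or it is below a point at which some edge is glued to
the edge of `p`. -/
lemma edge_eq_or {p q : 𝓔.Point} {b : ℝ} (hb : b ≤ 𝓔.top p.edge) (hpq : dist p q < b - p.ht) :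
    (q.edge = p.edge ∧ q.ht < b) ∨ ∃ c, 𝓔.par c = p.edge ∧ 𝓔.lev q.edge ≤ 𝓔.lev c ∧
      (𝓔.top c : ℝ) < b ∧ q.ht < 𝓔.top c := by
  have h1 : p.ht ≤ 𝓔.heightTree.join p q := 𝓔.heightTree.le_join_left p q
  have h2 : q.ht ≤ 𝓔.heightTree.join p q := 𝓔.heightTree.le_join_right p q
  rw [𝓔.heightTree.dist_eq, height_def, height_def] at hpq
  have hJ : 𝓔.heightTree.join p q < b := by linarith
  have he : 𝓔.edgeAt q.edge (𝓔.heightTree.join p q) = p.edge := by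
    have := congrArg Point.edge (𝓔.heightTree.up_join p q)
    rw [𝓔.edge_up_of_lt h1 (hJ.trans_le hb), edge_up, max_eq_right h2] at this
    exact this.symm
  rcases 𝓔.edgeAt_eq_or q.edge (𝓔.heightTree.join p q) with h3 | ⟨c, h3, h4, h5, h6⟩
  · exact Or.inl ⟨by rw [← h3, he], by linarith⟩
  · refine Or.inr ⟨c, by rw [h3, he], h4, h6.trans_lt hJ, q.lt_top.trans_le ?_⟩
    exact_mod_cast h5

lemma top_eq (c : E) : 𝓔.top c = 𝓔.base (𝓔.par c) + 𝓔.off c := (𝓔.base_par c).symm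

section Cells

variable {𝓔} {R : E → Prop}

/-- The maximal free segment of the subtree of level `k` that contains `p`. -/
def cell (R : E → Prop) (k : ℕ) (p : 𝓔.Point) : Set (𝓔.levelSet k) :=
  -- Only edges in `R` of level above `k` are cut into pieces of length `2 ^ k`. All others carry no
  -- branch point of level `k` and stay whole.
  {z | ¬ 𝓔.IsNode R k z ∧ (z : 𝓔.Point).edge = p.edge ∧ (R p.edge → k < 𝓔.lev p.edge →
    ⌊((z : 𝓔.Point).ht - 𝓔.base p.edge) / 2 ^ k⌋ = ⌊(p.ht - 𝓔.base p.edge) / 2 ^ k⌋)}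

lemma mem_cell_self {k : ℕ} (p : 𝓔.levelSet k) (hp : ¬ 𝓔.IsNode R k p) :
    p ∈ cell R k (p : 𝓔.Point) := ⟨hp, rfl, fun _ _ => rfl⟩

lemma mem_cell_of_mem {k : ℕ} {p q z : 𝓔.levelSet k} (hq : ¬ 𝓔.IsNode R k q)
    (hzp : z ∈ cell R k (p : 𝓔.Point)) (hzq : z ∈ cell R k (q : 𝓔.Point)) :
    q ∈ cell R k (p : 𝓔.Point) := by
  have e : (q : 𝓔.Point).edge = (p : 𝓔.Point).edge := hzq.2.1.symm.trans hzp.2.1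
  refine ⟨hq, e, fun h1 h2 => ?_⟩
  have h3 := hzq.2.2
  rw [e] at h3
  rw [← h3 h1 h2, hzp.2.2 h1 h2]

lemma cell_eq_of_not_split {k : ℕ} {p : 𝓔.Point} (hp : ¬ (R p.edge ∧ k < 𝓔.lev p.edge)) :
    cell R k p = {z : 𝓔.levelSet k | (z : 𝓔.Point).edge = p.edge} := by
  ext z
  refine ⟨fun hz => hz.2.1, fun hz => ⟨fun hn => ?_, hz, fun h1 h2 => absurd ⟨h1, h2⟩ hp⟩⟩
  have e : (z : 𝓔.Point).edge = p.edge := hz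
  exact hp ⟨e ▸ hn.1, e ▸ hn.2.1⟩

/-- The lower end of the part of length `2 ^ k` of an edge that contains a given point. -/
noncomputable def lowerEnd (k : ℕ) (p : 𝓔.Point) : ℝ :=
  𝓔.base p.edge + ⌊(p.ht - 𝓔.base p.edge) / 2 ^ k⌋ * 2 ^ k

lemma lowerEnd_le (k : ℕ) (p : 𝓔.Point) : lowerEnd k p ≤ p.ht := by
  have := Int.floor_le ((p.ht - 𝓔.base p.edge) / 2 ^ k)
  rw [le_div_iff₀ (by positivity)] at this
  unfold lowerEnd
  linarith

lemma lt_lowerEnd_add (k : ℕ) (p : 𝓔.Point) : p.ht < lowerEnd k p + 2 ^ k := by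
  have := Int.lt_floor_add_one ((p.ht - 𝓔.base p.edge) / 2 ^ k)
  rw [div_lt_iff₀ (by positivity)] at this
  unfold lowerEnd
  linarith

lemma exists_lowerEnd_eq (k : ℕ) (p : 𝓔.Point) :
    ∃ q : ℕ, lowerEnd k p = 𝓔.base p.edge + q * 2 ^ k := by
  have h0 : 0 ≤ ⌊(p.ht - 𝓔.base p.edge) / 2 ^ k⌋ :=
    Int.floor_nonneg.2 (div_nonneg (by linarith [p.base_le]) (by positivity))
  refine ⟨⌊(p.ht - 𝓔.base p.edge) / 2 ^ k⌋.toNat, ?_⟩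
  rw [lowerEnd]
  congr 2
  rw [← Int.cast_natCast, Int.toNat_of_nonneg h0]

lemma base_le_lowerEnd (k : ℕ) (p : 𝓔.Point) : 𝓔.base p.edge ≤ lowerEnd k p := by
  obtain ⟨q, hq⟩ := exists_lowerEnd_eq k p
  rw [hq]
  linarith [show (0 : ℝ) ≤ q * 2 ^ k by positivity]

/-- The length of the edge is a multiple of `2 ^ k`, so no piece sticks out. -/
lemma lowerEnd_add_le_top {k : ℕ} {p : 𝓔.Point} (hk : k ≤ 𝓔.lev p.edge) :
    lowerEnd k p + 2 ^ k ≤ 𝓔.top p.edge := by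
  obtain ⟨q, hq⟩ := exists_lowerEnd_eq k p
  have h1 := (lowerEnd_le k p).trans_lt p.lt_top
  obtain ⟨m, hm⟩ := Nat.exists_eq_add_of_le hk
  rw [hq] at h1 ⊢
  unfold top at h1 ⊢
  push_cast at h1 ⊢
  rw [hm, pow_add] at h1 ⊢
  have h2 : (q : ℝ) * 2 ^ k < 2 ^ m * 2 ^ k := by linarith
  have h3 : q < 2 ^ m := by exact_mod_cast lt_of_mul_lt_mul_right h2 (by positivity)
  have h4 : (q + 1 : ℝ) ≤ 2 ^ m := by exact_mod_cast h3
  have h5 : (q + 1 : ℝ) * 2 ^ k ≤ 2 ^ m * 2 ^ k := by gcongr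
  linarith

lemma floor_eq_iff_lowerEnd {k : ℕ} {p z : 𝓔.Point} :
    ⌊(z.ht - 𝓔.base p.edge) / 2 ^ k⌋ = ⌊(p.ht - 𝓔.base p.edge) / 2 ^ k⌋ ↔
      lowerEnd k p ≤ z.ht ∧ z.ht < lowerEnd k p + 2 ^ k := by
  rw [Int.floor_eq_iff, le_div_iff₀ (by positivity), div_lt_iff₀ (by positivity)]
  unfold lowerEnd
  constructor <;> rintro ⟨h1, h2⟩ <;> constructor <;> linarith

lemma cell_eq_of_split {k : ℕ} {p : 𝓔.Point} (hp : R p.edge) (hk : k < 𝓔.lev p.edge) :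
    cell R k p = {z : 𝓔.levelSet k | (z : 𝓔.Point).edge = p.edge ∧ lowerEnd k p < (z : 𝓔.Point).ht ∧
      (z : 𝓔.Point).ht < lowerEnd k p + 2 ^ k} := by
  ext z
  obtain ⟨q, hq⟩ := exists_lowerEnd_eq k p
  constructor
  · rintro ⟨h1, h2, h3⟩
    obtain ⟨h4, h5⟩ := floor_eq_iff_lowerEnd.1 (h3 hp hk)
    refine ⟨h2, lt_of_le_of_ne h4 fun h6 => h1 ⟨h2 ▸ hp, h2 ▸ hk, q, ?_⟩, h5⟩
    rw [← h6, hq, h2]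
  · rintro ⟨h2, h4, h5⟩
    refine ⟨?_, h2, fun _ _ => floor_eq_iff_lowerEnd.2 ⟨h4.le, h5⟩⟩
    rintro ⟨-, -, m, hm⟩
    rw [hm, h2, hq] at h4 h5
    have h6 : (q : ℝ) * 2 ^ k < m * 2 ^ k := by linarith
    have h7 : (m : ℝ) * 2 ^ k < (q + 1) * 2 ^ k := by linarith
    have h8 := lt_of_mul_lt_mul_right h6 (by positivity)
    have h9 := lt_of_mul_lt_mul_right h7 (by positivity)
    norm_cast at h8 h9
    omega

lemma isHalfOpenSegment_edge {k : ℕ} {e : E} (hk : k ≤ 𝓔.lev e) :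
    IsHalfOpenSegment {z : 𝓔.levelSet k | (z : 𝓔.Point).edge = e} := by
  let p : 𝓔.levelSet k := ⟨𝓔.bot e, hk⟩
  have hp : (𝓔.levelTree k).height p ≤ 𝓔.top e := (p : 𝓔.Point).lt_top.le
  refine ⟨p, (𝓔.levelTree k).up p (𝓔.top e), _, ?_, (𝓔.levelTree k).isGeodesicSegment_up hp, ?_⟩
  · intro h
    have := congrArg (𝓔.levelTree k).height h
    rw [(𝓔.levelTree k).height_up_of_le hp] at this
    exact (ne_of_lt (p : 𝓔.Point).lt_top) this
  · ext z
    constructor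
    · intro hz
      have hz' : (z : 𝓔.Point).edge = e := hz
      have h1 : (𝓔.base e : ℝ) ≤ (z : 𝓔.Point).ht := hz' ▸ (z : 𝓔.Point).base_le
      have h2 : (z : 𝓔.Point).ht < 𝓔.top e := hz' ▸ (z : 𝓔.Point).lt_top
      refine ⟨⟨h1, h2.le, ?_⟩, ?_⟩
      · exact Subtype.ext (𝓔.up_of_edge_eq (p := p) hz'.symm h1).symm
      · rintro rfl
        have h1 : 𝓔.par e = e := (𝓔.edge_up_top e (p := p) rfl).symm.trans hz
        have h2 := 𝓔.lev_lt e
        rw [h1] at h2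
        exact lt_irrefl _ h2
    · rintro ⟨⟨h1, h2, h3⟩, h4⟩
      have h5 : (𝓔.levelTree k).height z < 𝓔.top e := by
        refine lt_of_le_of_ne h2 fun h5 => h4 ?_
        rw [h3, h5]; rfl
      have h6 := congrArg (fun w : 𝓔.levelSet k => (w : 𝓔.Point).edge) h3
      exact h6.trans (𝓔.edge_up_of_lt (p := p) h1 h5)

lemma isOpenSegment_Ioo {k : ℕ} {e : E} (hk : k ≤ 𝓔.lev e) {a b : ℝ} (ha : 𝓔.base e ≤ a)
    (hab : a < b) (hb : b ≤ 𝓔.top e) :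
    IsOpenSegment {z : 𝓔.levelSet k | (z : 𝓔.Point).edge = e ∧ a < (z : 𝓔.Point).ht ∧
      (z : 𝓔.Point).ht < b} := by
  let p : 𝓔.levelSet k := ⟨⟨e, a, ha, hab.trans_le hb⟩, hk⟩
  have hp : (𝓔.levelTree k).height p ≤ b := hab.le
  refine ⟨p, (𝓔.levelTree k).up p b, _, ?_, (𝓔.levelTree k).isGeodesicSegment_up hp, ?_⟩
  · intro h
    have := congrArg (𝓔.levelTree k).height h
    rw [(𝓔.levelTree k).height_up_of_le hp] at this
    exact (ne_of_lt hab) this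
  · ext z
    constructor
    · rintro ⟨hz, hz1, hz2⟩
      refine ⟨⟨hz1.le, hz2.le, ?_⟩, ?_⟩
      · exact Subtype.ext (𝓔.up_of_edge_eq (p := p) hz.symm hz1.le).symm
      · rintro (rfl | h)
        · exact lt_irrefl _ hz1
        · have h1 := congrArg (𝓔.levelTree k).height h
          rw [(𝓔.levelTree k).height_up_of_le hp] at h1
          exact hz2.ne h1
    · rintro ⟨⟨h1, h2, h3⟩, h4⟩
      have h5 : (𝓔.levelTree k).height z < b := by
        refine lt_of_le_of_ne h2 fun h5 => h4 (Or.inr ?_)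
        rw [h3, h5]; rfl
      have h6 : (𝓔.levelTree k).height p < (𝓔.levelTree k).height z := by
        refine lt_of_le_of_ne h1 fun h6 => h4 (Or.inl ?_)
        rw [h3, ← h6, HeightData.up_self]
      have h7 := congrArg (fun w : 𝓔.levelSet k => (w : 𝓔.Point).edge) h3
      exact ⟨h7.trans (𝓔.edge_up_of_lt (p := p) h1 (h5.trans_le hb)), h6, h5⟩

variable (hR : 𝓔.IsBranched R)

include hR

/-- A nearby point of the subtree on another edge would have to come up through an edge of level at
least `k`. Such edges are glued at multiples of `2 ^ k`, hence not inside an open piece, and edges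
that stay whole have no such children. -/
lemma isOpen_cell {k : ℕ} (p : 𝓔.levelSet k) : IsOpen (cell R k (p : 𝓔.Point)) := by
  have hk : k ≤ 𝓔.lev (p : 𝓔.Point).edge := p.2
  rw [Metric.isOpen_iff]
  by_cases hs : R (p : 𝓔.Point).edge ∧ k < 𝓔.lev (p : 𝓔.Point).edge
  · rw [cell_eq_of_split hs.1 hs.2]
    rintro z ⟨h1, h2, h3⟩
    set a := lowerEnd k (p : 𝓔.Point) with ha
    have hb : a + 2 ^ k ≤ 𝓔.top (z : 𝓔.Point).edge := by rw [h1]; exact lowerEnd_add_le_top hk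
    refine ⟨min ((z : 𝓔.Point).ht - a) (a + 2 ^ k - (z : 𝓔.Point).ht),
      lt_min (by linarith) (by linarith), fun q hq => ?_⟩
    rw [Metric.mem_ball, dist_comm, lt_min_iff] at hq
    have h6 : |(z : 𝓔.Point).ht - (q : 𝓔.Point).ht| ≤ dist z q :=
      𝓔.heightTree.abs_height_sub_le z q
    rw [abs_le] at h6
    rcases 𝓔.edge_eq_or hb hq.2 with ⟨h4, h5⟩ | ⟨c, h4, h5, h7, h8⟩
    · exact ⟨h4.trans h1, by linarith, h5⟩
    · exfalso
      have hkc : k ≤ 𝓔.lev c := le_trans q.2 h5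
      obtain ⟨m, hm⟩ := (pow_dvd_pow 2 hkc).trans (𝓔.dvd_off c)
      obtain ⟨n, hn⟩ := exists_lowerEnd_eq k (p : 𝓔.Point)
      have h9 : (𝓔.top c : ℝ) = 𝓔.base (p : 𝓔.Point).edge + m * 2 ^ k := by
        rw [𝓔.top_eq, h4, h1, hm]; push_cast; ring
      rw [h9, ha, hn] at h7
      have h10 : (m : ℝ) * 2 ^ k < (n + 1) * 2 ^ k := by linarith
      have h11 := lt_of_mul_lt_mul_right h10 (by positivity)
      have h12 : (m : ℝ) ≤ n := by norm_cast at h11 ⊢; omega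
      have h13 : (m : ℝ) * 2 ^ k ≤ n * 2 ^ k := by gcongr
      linarith
  · rw [cell_eq_of_not_split hs]
    intro z hz
    refine ⟨𝓔.top (z : 𝓔.Point).edge - (z : 𝓔.Point).ht, sub_pos.2 (z : 𝓔.Point).lt_top,
      fun q hq => ?_⟩
    rw [Metric.mem_ball, dist_comm] at hq
    rcases 𝓔.edge_eq_or le_rfl hq with ⟨h4, h5⟩ | ⟨c, h4, h5, h7, h8⟩
    · exact h4.trans hz
    · exfalso
      have hz' : (z : 𝓔.Point).edge = (p : 𝓔.Point).edge := hz
      refine hs ⟨hz' ▸ h4 ▸ hR.par_mem c, ?_⟩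
      rw [← hz', ← h4]
      exact lt_of_le_of_lt (le_trans q.2 h5) (𝓔.lev_lt c)

lemma isFreeSegment_cell {k : ℕ} (p : 𝓔.levelSet k) : IsFreeSegment (cell R k (p : 𝓔.Point)) := by
  refine ⟨?_, isOpen_cell hR p⟩
  by_cases hs : R (p : 𝓔.Point).edge ∧ k < 𝓔.lev (p : 𝓔.Point).edge
  · right
    rw [cell_eq_of_split hs.1 hs.2]
    exact isOpenSegment_Ioo p.2 (base_le_lowerEnd _ _) (by linarith [pow_pos (zero_lt_two (α := ℝ)) k])
      (lowerEnd_add_le_top p.2)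
  · left
    rw [cell_eq_of_not_split hs]
    exact isHalfOpenSegment_edge p.2

/-- Free segments contain no branch points. -/
lemma not_isNode_of_mem {k : ℕ} {S : Set (𝓔.levelSet k)} (hS : IsFreeSegment S)
    {p : 𝓔.levelSet k} (hp : p ∈ S) : ¬ 𝓔.IsNode R k p := by
  rintro ⟨h1, h2, q, hq⟩
  have hq' : q * 2 ^ k < 2 ^ 𝓔.lev (p : 𝓔.Point).edge := by
    have := (p : 𝓔.Point).lt_top
    rw [hq, top] at this
    push_cast at this
    have : (q : ℝ) * 2 ^ k < 2 ^ 𝓔.lev (p : 𝓔.Point).edge := by linarith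
    exact_mod_cast this
  -- Two twins are needed: if `p` is the lower end of its edge, the edge itself contributes no
  -- downward direction. Points on both twins and one above `p` form the tripod.
  obtain ⟨c, c', hne, ⟨l1, l2, l3⟩, ⟨l1', l2', l3'⟩⟩ := hR.exists_twins _ h1 k q h2 hq'
  obtain ⟨ε, hε, hball⟩ := Metric.isOpen_iff.1 hS.2 p hp
  -- As edges have length at least `1`, the condition `δ < 1` leaves room for a point at depth `δ`
  -- below `p` on each twin.
  obtain ⟨δ, hδ, hδε, hδ1⟩ : ∃ δ : ℝ, 0 < δ ∧ δ < ε ∧ δ < 1 :=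
    ⟨min (ε / 2) (1 / 2), by positivity, (min_le_left _ _).trans_lt (by linarith),
      (min_le_right _ _).trans_lt (by norm_num)⟩
  have key : ∀ c, 𝓔.lev c = k → 𝓔.par c = (p : 𝓔.Point).edge → 𝓔.off c = q * 2 ^ k →
      (𝓔.top c : ℝ) = (p : 𝓔.Point).ht ∧
      ∃ z : 𝓔.levelSet k, (z : 𝓔.Point).edge = c ∧ (z : 𝓔.Point).ht = (p : 𝓔.Point).ht - δ ∧
        (𝓔.levelTree k).up z (p : 𝓔.Point).ht = p := by
    intro c l1 l2 l3
    have ht : (𝓔.top c : ℝ) = (p : 𝓔.Point).ht := by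
      rw [hq, 𝓔.top_eq, l2, l3]; push_cast; ring
    have hb : (𝓔.base c : ℝ) ≤ 𝓔.top c - 1 := by
      exact_mod_cast Int.le_sub_one_of_lt (𝓔.base_lt_top c)
    obtain ⟨z, hz1, hz2⟩ : ∃ z : 𝓔.levelSet k, (z : 𝓔.Point).edge = c ∧
        (z : 𝓔.Point).ht = (p : 𝓔.Point).ht - δ :=
      ⟨⟨⟨c, (p : 𝓔.Point).ht - δ, by linarith, by linarith⟩, l1.ge⟩, rfl, rfl⟩
    refine ⟨ht, z, hz1, hz2, ?_⟩
    apply Subtype.ext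
    rw [coe_levelTree_up]
    ext
    · rw [← ht, 𝓔.edge_up_top c hz1, l2]
    · exact 𝓔.ht_up (by linarith)
  obtain ⟨ht, z, hz1, hz2, hz3⟩ := key c l1 l2 l3
  obtain ⟨ht', z', hz1', hz2', hz3'⟩ := key c' l1' l2' l3'
  have hpz : ∀ z : 𝓔.levelSet k, (z : 𝓔.Point).ht = (p : 𝓔.Point).ht - δ →
      (𝓔.levelTree k).up z (p : 𝓔.Point).ht = p → dist z p = δ ∧
      dist z ((𝓔.levelTree k).up p ((p : 𝓔.Point).ht + δ)) = 2 * δ := by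
    intro z h3 h4
    have h5 : (𝓔.levelTree k).height z = (p : 𝓔.Point).ht - δ := h3
    constructor
    · have := (𝓔.levelTree k).dist_up (p := z) (t := (p : 𝓔.Point).ht) (by linarith)
      rw [h4, h5] at this
      linarith
    · have := (𝓔.levelTree k).dist_up (p := z) (t := (p : 𝓔.Point).ht + δ) (by linarith)
      rw [← (𝓔.levelTree k).up_up_of_le z (s := (p : 𝓔.Point).ht) (by linarith), h4, h5] at this
      linarith
  obtain ⟨d1, d2⟩ := hpz z hz2 hz3
  obtain ⟨d1', d2'⟩ := hpz z' hz2' hz3'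
  have d3 : dist p ((𝓔.levelTree k).up p ((p : 𝓔.Point).ht + δ)) = δ := by
    have := (𝓔.levelTree k).dist_up (p := p) (t := (p : 𝓔.Point).ht + δ)
      (by rw [levelTree_height]; linarith)
    rw [this, levelTree_height]; ring
  -- Below `p` the two rays run on different edges.
  have hJ : (p : 𝓔.Point).ht ≤ (𝓔.levelTree k).join z z' := by
    by_contra hJ
    rw [not_le] at hJ
    apply hne
    have e := (𝓔.levelTree k).up_join z z'
    have e1 := congrArg (fun w : 𝓔.levelSet k => (w : 𝓔.Point).edge) e
    simp only [coe_levelTree_up] at e1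
    rw [𝓔.edge_up_of_lt ((𝓔.levelTree k).le_join_left z z') (by rw [hz1, ht]; exact hJ),
      𝓔.edge_up_of_lt ((𝓔.levelTree k).le_join_right z z') (by rw [hz1', ht']; exact hJ),
      hz1, hz1'] at e1
    exact e1
  have d4 : dist z z' = 2 * δ := by
    apply le_antisymm
    · have := dist_triangle z p z'
      rw [dist_comm p z', d1, d1'] at this
      linarith
    · rw [(𝓔.levelTree k).dist_eq, levelTree_height, levelTree_height, hz2, hz2']
      linarith
  refine (𝓔.levelTree k).not_tripod hS (a := z) (b := z')
    (c := (𝓔.levelTree k).up p ((p : 𝓔.Point).ht + δ)) (δ := 2 * δ) (by linarith)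
    (hball ?_) (hball ?_) (hball ?_) d4 d2 d2'
  · rw [Metric.mem_ball, d1]; exact hδε
  · rw [Metric.mem_ball, d1']; exact hδε
  · rw [Metric.mem_ball, dist_comm, d3]; exact hδε

/-- A ray that does not hit a branch point stays in one cell. -/
lemma up_mem_cell {k : ℕ} {p : 𝓔.levelSet k} {t : ℝ} (ht : (p : 𝓔.Point).ht ≤ t)
    (hn : ∀ s, (p : 𝓔.Point).ht ≤ s → s ≤ t → ¬ 𝓔.IsNode R k ((𝓔.levelTree k).up p s)) :
    (𝓔.levelTree k).up p t ∈ cell R k (p : 𝓔.Point) := by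
  have hk : k ≤ 𝓔.lev (p : 𝓔.Point).edge := p.2
  have htop : t < 𝓔.top (p : 𝓔.Point).edge := by
    by_contra h
    rw [not_lt] at h
    refine hn _ (p : 𝓔.Point).lt_top.le h ?_
    rw [coe_levelTree_up, IsNode, 𝓔.edge_up_top _ rfl, 𝓔.ht_up (p : 𝓔.Point).lt_top.le]
    obtain ⟨m, hm⟩ := (pow_dvd_pow 2 hk).trans (𝓔.dvd_off (p : 𝓔.Point).edge)
    refine ⟨hR.par_mem _, hk.trans_lt (𝓔.lev_lt _), m, ?_⟩
    rw [𝓔.top_eq, hm]; push_cast; ring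
  have hedge : (𝓔.heightTree.up (p : 𝓔.Point) t).edge = (p : 𝓔.Point).edge :=
    𝓔.edge_up_of_lt ht htop
  refine ⟨hn t ht le_rfl, hedge, fun h1 h2 => ?_⟩
  rw [floor_eq_iff_lowerEnd, coe_levelTree_up, 𝓔.ht_up ht]
  refine ⟨(lowerEnd_le _ _).trans ht, ?_⟩
  by_contra h
  rw [not_lt] at h
  have h3 := (lt_lowerEnd_add k (p : 𝓔.Point)).le
  refine hn _ h3 h ?_
  rw [coe_levelTree_up, IsNode, 𝓔.edge_up_of_lt h3 (h.trans_lt htop), 𝓔.ht_up h3]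
  obtain ⟨m, hm⟩ := exists_lowerEnd_eq k (p : 𝓔.Point)
  exact ⟨h1, h2, m + 1, by rw [hm]; push_cast; ring⟩

/-- By convexity the ascents from `p` and `q` to their merging point stay in `S`, so they meet no
branch point and the merging point lies in the cells of both. -/
lemma subset_cell {k : ℕ} {S : Set (𝓔.levelSet k)} (hS : IsFreeSegment S)
    {p : 𝓔.levelSet k} (hp : p ∈ S) : S ⊆ cell R k (p : 𝓔.Point) := by
  intro q hq
  have hconv := ((𝓔.levelTree k).exists_of_isFreeSegment hS).2
  have hl := (𝓔.levelTree k).le_join_left p q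
  have hr := (𝓔.levelTree k).le_join_right p q
  have h1 : (𝓔.levelTree k).up p ((𝓔.levelTree k).join p q) ∈ cell R k (p : 𝓔.Point) :=
    up_mem_cell hR hl fun s h1 h2 => not_isNode_of_mem hR hS
      (hconv p hp q hq _ ((𝓔.levelTree k).dist_up_add_left h1 h2))
  have h2 : (𝓔.levelTree k).up q ((𝓔.levelTree k).join p q) ∈ cell R k (q : 𝓔.Point) :=
    up_mem_cell hR hr fun s h1 h2 => not_isNode_of_mem hR hS
      (hconv p hp q hq _ ((𝓔.levelTree k).dist_up_add_right h1 h2))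
  rw [(𝓔.levelTree k).up_join p q] at h1
  exact mem_cell_of_mem (not_isNode_of_mem hR hS hq) h1 h2

lemma maximal_cell {k : ℕ} {p : 𝓔.levelSet k} (hp : ¬ 𝓔.IsNode R k p) :
    Maximal IsFreeSegment (cell R k (p : 𝓔.Point)) :=
  ⟨isFreeSegment_cell hR p, fun _ hS hle => subset_cell hR hS (hle (mem_cell_self p hp))⟩

omit hR in
lemma diam_eq {k : ℕ} {e : E} {a b : ℝ} (hk : k ≤ 𝓔.lev e) (ha : 𝓔.base e ≤ a) (hab : a < b)
    (hb : b ≤ 𝓔.top e) {C : Set (𝓔.levelSet k)}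
    (h1 : ∀ z ∈ C, (z : 𝓔.Point).edge = e ∧ a ≤ (z : 𝓔.Point).ht ∧ (z : 𝓔.Point).ht ≤ b)
    (h2 : ∀ z : 𝓔.levelSet k, (z : 𝓔.Point).edge = e → a < (z : 𝓔.Point).ht →
      (z : 𝓔.Point).ht < b → z ∈ C) : Metric.diam C = b - a := by
  have hle : ∀ z ∈ C, ∀ w ∈ C, dist z w ≤ b - a := by
    intro z hz w hw
    obtain ⟨z1, z2, z3⟩ := h1 z hz
    obtain ⟨w1, w2, w3⟩ := h1 w hw
    rw [Subtype.dist_eq, 𝓔.dist_of_edge_eq (z1.trans w1.symm), abs_le]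
    constructor <;> linarith
  apply le_antisymm (Metric.diam_le_of_forall_dist_le (by linarith) hle)
  refine le_of_forall_lt fun r hr => ?_
  obtain ⟨δ, hδ, hδr, hδab⟩ : ∃ δ : ℝ, 0 < δ ∧ r < b - a - 2 * δ ∧ 2 * δ < b - a :=
    ⟨min ((b - a - r) / 4) ((b - a) / 4), lt_min (by linarith) (by linarith),
      by linarith [min_le_left ((b - a - r) / 4) ((b - a) / 4)],
      by linarith [min_le_right ((b - a - r) / 4) ((b - a) / 4)]⟩
  let z : 𝓔.levelSet k := ⟨⟨e, a + δ, by linarith, by linarith⟩, hk⟩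
  let w : 𝓔.levelSet k := ⟨⟨e, b - δ, by linarith, by linarith⟩, hk⟩
  have hz : z ∈ C := h2 z rfl (by change a < a + δ; linarith) (by change a + δ < b; linarith)
  have hw : w ∈ C := h2 w rfl (by change a < b - δ; linarith) (by change b - δ < b; linarith)
  have hd : dist z w = b - a - 2 * δ := by
    rw [Subtype.dist_eq, 𝓔.dist_of_edge_eq (p := z) (q := w) rfl]
    change |a + δ - (b - δ)| = _
    rw [abs_sub_comm, abs_of_nonneg (by linarith)]
    ring
  have := Metric.dist_le_diam_of_mem (Metric.isBounded_iff.2 ⟨b - a, fun x hx y hy => hle x hx y hy⟩)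
    hz hw
  linarith

omit hR in
lemma diam_edge {k : ℕ} {e : E} (hk : k ≤ 𝓔.lev e) :
    Metric.diam {z : 𝓔.levelSet k | (z : 𝓔.Point).edge = e} = 2 ^ 𝓔.lev e := by
  rw [diam_eq (e := e) (a := 𝓔.base e) (b := 𝓔.top e) hk le_rfl
    (by exact_mod_cast 𝓔.base_lt_top e) le_rfl]
  · rw [top]; push_cast; ring
  · rintro z rfl
    exact ⟨rfl, (z : 𝓔.Point).base_le, (z : 𝓔.Point).lt_top.le⟩
  · exact fun z hz _ _ => hz

omit hR in
lemma le_diam_cell {k : ℕ} (p : 𝓔.levelSet k) : 2 ^ k ≤ Metric.diam (cell R k (p : 𝓔.Point)) := by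
  by_cases hs : R (p : 𝓔.Point).edge ∧ k < 𝓔.lev (p : 𝓔.Point).edge
  · rw [cell_eq_of_split hs.1 hs.2, diam_eq p.2 (base_le_lowerEnd _ _)
      (by linarith [pow_pos (zero_lt_two (α := ℝ)) k]) (lowerEnd_add_le_top p.2)]
    · linarith
    · exact fun z hz => ⟨hz.1, hz.2.1.le, hz.2.2.le⟩
    · exact fun z h1 h2 h3 => ⟨h1, h2, h3⟩
  · rw [cell_eq_of_not_split hs, diam_edge p.2]
    exact pow_le_pow_right₀ one_le_two p.2

omit hR in
lemma cell_bot {k : ℕ} {e : E} (hk : 𝓔.lev e = k) :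
    cell R k (𝓔.bot e) = {z : 𝓔.levelSet k | (z : 𝓔.Point).edge = e} :=
  cell_eq_of_not_split fun h => absurd hk h.2.ne'

lemma maximal_edge {k : ℕ} {e : E} (hk : 𝓔.lev e = k) :
    Maximal IsFreeSegment {z : 𝓔.levelSet k | (z : 𝓔.Point).edge = e} := by
  rw [← cell_bot (R := R) hk]
  exact maximal_cell hR (p := ⟨𝓔.bot e, hk.ge⟩) fun h => h.2.1.ne' hk

/-- Branched trees are binary regular. -/
theorem isBinaryRegularTree [Nonempty E] : IsBinaryRegularTree 𝓔.levelSet where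
  zero := eq_univ_of_forall fun _ => Nat.zero_le _
  antitone _ _ hij _ hp := le_trans hij hp
  isRTree k := (𝓔.levelTree k).isRTree
  iInter := by
    refine eq_empty_of_forall_notMem fun p hp => ?_
    have := mem_iInter.1 hp (𝓔.lev p.edge + 1)
    exact absurd this (Nat.not_succ_le_self _)
  diff k := by
    refine ⟨{S | ∃ e, 𝓔.lev e = k ∧ S = {z : 𝓔.levelSet k | (z : 𝓔.Point).edge = e}},
      ?_, ⟨2 ^ k, ?_⟩, ?_, ?_⟩
    · rintro _ ⟨e, he, rfl⟩
      exact ⟨isHalfOpenSegment_edge he.ge, maximal_edge hR he⟩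
    · rintro _ ⟨e, he, rfl⟩
      rw [diam_edge he.ge, he]
    · rintro _ ⟨e, he, rfl⟩ _ ⟨e', he', rfl⟩ hne
      refine disjoint_left.2 fun z hz hz' => hne ?_
      have : e = e' := Eq.trans (Eq.symm hz) hz'
      rw [this]
    · ext z
      constructor
      · rintro ⟨_, ⟨e, he, rfl⟩, hz⟩ hz'
        have h1 : k + 1 ≤ 𝓔.lev (z : 𝓔.Point).edge := hz'
        have h2 : (z : 𝓔.Point).edge = e := hz
        rw [h2, he] at h1
        omega
      · intro hz
        have h1 : k ≤ 𝓔.lev (z : 𝓔.Point).edge := z.2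
        have h2 : ¬ k + 1 ≤ 𝓔.lev (z : 𝓔.Point).edge := hz
        exact ⟨_, ⟨(z : 𝓔.Point).edge, by omega, rfl⟩, rfl⟩
  mesh k := by
    obtain ⟨e₀⟩ := ‹Nonempty E›
    constructor
    · rintro _ ⟨S, hS, rfl⟩
      -- The empty set is not maximal, since a cell has positive diameter.
      have hne : S.Nonempty := by
        by_contra hne
        rw [not_nonempty_iff_eq_empty] at hne
        subst hne
        have hp : 𝓔.bot (𝓔.par^[k] e₀) ∈ 𝓔.levelSet k :=
          le_trans (Nat.le_add_left _ _) (𝓔.lev_add_le e₀ k)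
        have hlt : 0 < Metric.diam (∅ : Set (𝓔.levelSet k)) :=
          lt_of_lt_of_le (by positivity) ((le_diam_cell (R := R) ⟨_, hp⟩).trans_eq
            (congrArg _ (subset_empty_iff.1 (hS.2 (isFreeSegment_cell hR ⟨_, hp⟩)
              (empty_subset _)))))
        rw [Metric.diam_empty] at hlt
        exact lt_irrefl _ hlt
      obtain ⟨p, hp⟩ := hne
      have h1 := subset_cell hR hS.1 hp
      have h2 : S = cell R k (p : 𝓔.Point) := h1.antisymm (hS.2 (isFreeSegment_cell hR p) h1)
      rw [h2]
      exact le_diam_cell p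
    · intro b hb
      have hlev : k < 𝓔.lev (𝓔.par^[k + 1] e₀) := by
        have := 𝓔.lev_add_le e₀ (k + 1)
        omega
      -- An edge of level exactly `k`, provided by branching at a high ancestor, attains the bound.
      obtain ⟨c, -, -, ⟨hc, -⟩, -⟩ := hR.exists_twins (𝓔.par^[k + 1] e₀)
        (by rw [Function.iterate_succ_apply']; exact hR.par_mem _) k 0 hlev (by simp)
      exact hb ⟨_, maximal_edge hR hc, by rw [diam_edge hc.ge, hc]⟩
  strictMono := pow_right_strictMono₀ one_lt_two
  tendsto := tendsto_pow_atTop_atTop_of_one_lt one_lt_two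

/-- The points at the lower ends of edges are limits of points of all smaller levels. -/
lemma bot_mem_frontier {e : E} (he : R e) {j : ℕ} (hj : 𝓔.lev e = j + 1) :
    𝓔.bot e ∈ frontier (𝓔.levelSet j \ 𝓔.levelSet (j + 1)) := by
  obtain ⟨c, -, -, ⟨h1, h2, h3⟩, -⟩ := hR.exists_twins e he j 0 (by omega) (by simp)
  have ht : (𝓔.top c : ℝ) = 𝓔.base e := by rw [𝓔.top_eq, h2, h3]; simp
  have hb : (𝓔.base c : ℝ) ≤ 𝓔.top c - 1 := by
    exact_mod_cast Int.le_sub_one_of_lt (𝓔.base_lt_top c)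
  rw [frontier]
  refine ⟨Metric.mem_closure_iff.2 fun ε hε => ?_, fun h => ?_⟩
  · obtain ⟨δ, hδ, hδε, hδ1⟩ : ∃ δ : ℝ, 0 < δ ∧ δ < ε ∧ δ < 1 :=
      ⟨min (ε / 2) (1 / 2), by positivity, (min_le_left _ _).trans_lt (by linarith),
        (min_le_right _ _).trans_lt (by norm_num)⟩
    let z : 𝓔.Point := ⟨c, 𝓔.base e - δ, by linarith, by linarith⟩
    have hz : z.ht ≤ 𝓔.top c := z.lt_top.le
    have hup : 𝓔.heightTree.up z (𝓔.top c) = 𝓔.bot e := by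
      ext
      · rw [𝓔.edge_up_top c rfl, h2]; rfl
      · rw [𝓔.ht_up hz, ht]; rfl
    refine ⟨z, ⟨h1.ge, fun h => ?_⟩, ?_⟩
    · have : j + 1 ≤ 𝓔.lev c := h
      omega
    · have := 𝓔.heightTree.dist_up (p := z) (t := 𝓔.top c) hz
      rw [hup, height_def] at this
      rw [dist_comm, this, ht]
      change (𝓔.base e : ℝ) - (𝓔.base e - δ) < ε
      linarith
  · exact (interior_subset h).2 hj.ge

end Cells

end EdgeTree

/-! ### Retraction to lower ends, and decoration by twigs. -/

namespace EdgeTree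

variable {E : Type*} (𝓔 : EdgeTree E)

/-- A ray that enters an edge of level `k` at its lower end is retracted to this lower end. -/
lemma canonicalRetract_bot {k : ℕ} {p : 𝓔.Point} {e : E} (he : 𝓔.lev e = k)
    (hp : p.ht ≤ 𝓔.base e) (hup : 𝓔.heightTree.up p (𝓔.base e) = 𝓔.bot e) :
    CanonicalRetract (𝓔.levelSet k) p (𝓔.bot e) := by
  rw [← hup]
  refine 𝓔.heightTree.canonicalRetract 𝓔.up_mem_levelSet hp (hup ▸ he.ge) fun s hs hse hk => ?_
  replace hs : p.ht ≤ s := hs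
  have h1 : k ≤ 𝓔.lev (𝓔.edgeAt p.edge s) := by
    have : k ≤ 𝓔.lev (𝓔.heightTree.up p s).edge := hk
    rwa [edge_up, max_eq_right hs] at this
  have h2 : 𝓔.edgeAt (𝓔.edgeAt p.edge s) (𝓔.base e) = e := by
    have := congrArg Point.edge hup
    rw [edge_up, max_eq_right hp] at this
    rw [𝓔.edgeAt_edgeAt _ hse.le, this]
    rfl
  -- From an edge of level at least `k`, the ray could reach `e` only by being on `e` already,
  -- impossible below its lower end, or through a child of `e`, whose level is less than `k`.
  rcases 𝓔.edgeAt_eq_or (𝓔.edgeAt p.edge s) (𝓔.base e) with h3 | ⟨c, h3, h4, -⟩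
  · have h5 := 𝓔.base_edgeAt_le (p.base_le.trans hs)
    rw [← h3, h2] at h5
    linarith
  · have h5 := 𝓔.lev_lt c
    rw [h3, h2] at h5
    omega

/-- The positions at which an edge of level `l` can be glued to a given edge of higher level. -/
abbrev Twig : Type _ :=
  {d : E × ℕ × ℕ × Bool // d.2.1 < 𝓔.lev d.1 ∧ d.2.2.1 * 2 ^ d.2.1 < 2 ^ 𝓔.lev d.1}

/-- To each edge glue two additional edges of each lower level at each possible position. -/
def decorate : EdgeTree (E ⊕ 𝓔.Twig) where
  lev := Sum.elim 𝓔.lev fun d => d.1.2.1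
  -- Twigs are glued only to original edges, and nothing is glued to a twig; this keeps the sets of
  -- children finite.
  par x := Sum.inl (Sum.elim 𝓔.par (fun d => d.1.1) x)
  off := Sum.elim 𝓔.off fun d => d.1.2.2.1 * 2 ^ d.1.2.1
  base := Sum.elim 𝓔.base fun d => 𝓔.base d.1.1 + d.1.2.2.1 * 2 ^ d.1.2.1 - 2 ^ d.1.2.1
  lev_lt := by
    rintro (e | d)
    · exact 𝓔.lev_lt e
    · exact d.2.1
  off_lt := by
    rintro (e | d)
    · exact 𝓔.off_lt e
    · exact d.2.2
  dvd_off := by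
    rintro (e | d)
    · exact 𝓔.dvd_off e
    · exact Dvd.intro_left _ rfl
  base_par := by
    rintro (e | d)
    · exact 𝓔.base_par e
    · simp
  directed := by
    have key : ∀ (e : E) (n : ℕ), (fun x : E ⊕ 𝓔.Twig =>
        (Sum.inl (Sum.elim 𝓔.par (fun d => d.1.1) x) : E ⊕ 𝓔.Twig))^[n] (Sum.inl e) =
          Sum.inl (𝓔.par^[n] e) := by
      intro e n
      induction n with
      | zero => rfl
      | succ n ih => rw [Function.iterate_succ_apply', ih, Function.iterate_succ_apply']; rfl
    intro x y
    obtain ⟨m, n, h⟩ := 𝓔.directed (Sum.elim 𝓔.par (fun d => d.1.1) x)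
      (Sum.elim 𝓔.par (fun d => d.1.1) y)
    exact ⟨m + 1, n + 1, by rw [Function.iterate_succ_apply, Function.iterate_succ_apply, key, key, h]⟩
  finite_children := by
    rintro (e | d)
    · have h1 : (Sum.inl '' {c | 𝓔.par c = e} : Set (E ⊕ 𝓔.Twig)).Finite :=
        (𝓔.finite_children e).image _
      have h2 : (Sum.inr '' {d : 𝓔.Twig | d.1.1 = e} : Set (E ⊕ 𝓔.Twig)).Finite := by
        refine Finite.image _ (Finite.of_finite_image (f := Subtype.val) ?_
          Subtype.val_injective.injOn)
        refine ((finite_singleton e).prod ((finite_Iio (𝓔.lev e)).prod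
          ((finite_Iio (2 ^ 𝓔.lev e)).prod (finite_univ (α := Bool))))).subset ?_
        rintro _ ⟨d, rfl, rfl⟩
        exact ⟨rfl, d.2.1, lt_of_le_of_lt (Nat.le_mul_of_pos_right _ (by positivity)) d.2.2,
          trivial⟩
      refine (h1.union h2).subset ?_
      rintro (c | d) hc
      · exact Or.inl ⟨c, Sum.inl_injective hc, rfl⟩
      · exact Or.inr ⟨d, Sum.inl_injective hc, rfl⟩
    · convert finite_empty
      ext x
      simp

lemma isBranched_decorate : 𝓔.decorate.IsBranched fun x => ∃ e, x = Sum.inl e where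
  par_mem _ := ⟨_, rfl⟩
  exists_twins := by
    rintro _ ⟨e, rfl⟩ l q hl hq
    refine ⟨Sum.inr ⟨(e, l, q, true), hl, hq⟩, Sum.inr ⟨(e, l, q, false), hl, hq⟩, ?_,
      ⟨rfl, rfl, rfl⟩, ⟨rfl, rfl, rfl⟩⟩
    simp

end EdgeTree

/-! ### Towers of families of sets -/

section Towers

variable {X : Type u} [MetricSpace X]

/-- In the definition of `AsdimLE` one may ask for nonempty sets, and for one member of each of the
families to contain a given ball. -/
lemma AsdimLE.exists_cover {n : ℕ} (hX : AsdimLE X n) (x₀ : X) {D R : ℝ} (hD : 0 < D)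
    (hR : 0 ≤ R) : ∃ 𝒰 : Fin (n + 1) → Set (Set X),
      (∀ x : X, ∃ i, ∃ A ∈ 𝒰 i, x ∈ A) ∧
      (∃ C : ℝ, 0 ≤ C ∧ ∀ i, ∀ A ∈ 𝒰 i, ∀ a ∈ A, ∀ b ∈ A, dist a b ≤ C) ∧
      (∀ i, ∀ A ∈ 𝒰 i, ∀ B ∈ 𝒰 i, A ≠ B → ∀ a ∈ A, ∀ b ∈ B, D ≤ dist a b) ∧
      (∀ i, ∀ A ∈ 𝒰 i, A.Nonempty) ∧
      ∀ i, ∃ A ∈ 𝒰 i, Metric.closedBall x₀ R ⊆ A := by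
  obtain ⟨𝒰, hcov, ⟨C, hC⟩, hsep⟩ := hX D hD
  -- All members within `D` of the ball are merged with it, so what remains is at distance at least
  -- `D` from the merged set.
  let near : Fin (n + 1) → Set (Set X) := fun i =>
    {A | A ∈ 𝒰 i ∧ ∃ a ∈ A, ∃ b ∈ Metric.closedBall x₀ R, dist a b < D}
  let big : Fin (n + 1) → Set X := fun i => Metric.closedBall x₀ R ∪ ⋃₀ near i
  have hbig : ∀ i, ∀ a ∈ big i, dist a x₀ ≤ |C| + D + R := by
    rintro i a (ha | ⟨A, ⟨hA, b, hb, c, hc, hbc⟩, ha⟩)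
    · rw [Metric.mem_closedBall] at ha
      linarith [abs_nonneg C]
    · rw [Metric.mem_closedBall] at hc
      have h1 := hC i A hA a ha b hb
      have h2 := dist_triangle4 a b c x₀
      linarith [le_abs_self C]
  have hfar : ∀ i, ∀ A ∈ 𝒰 i, A ∉ near i → ∀ a ∈ A, ∀ b ∈ big i, D ≤ dist a b := by
    rintro i A hA hAn a ha b (hb | ⟨B, hB, hb⟩)
    · by_contra h
      exact hAn ⟨hA, a, ha, b, hb, not_le.1 h⟩
    · exact hsep i A hA B hB.1 (fun e => hAn (e ▸ hB)) a ha b hb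
  refine ⟨fun i => insert (big i) {A | A ∈ 𝒰 i ∧ A.Nonempty ∧ A ∉ near i}, ?_,
    ⟨2 * (|C| + D + R), by positivity, ?_⟩, ?_, ?_, ?_⟩
  · intro x
    obtain ⟨i, A, hA, hx⟩ := hcov x
    by_cases hAn : A ∈ near i
    · exact ⟨i, _, mem_insert _ _, Or.inr ⟨A, hAn, hx⟩⟩
    · exact ⟨i, A, Or.inr ⟨hA, ⟨x, hx⟩, hAn⟩, hx⟩
  · rintro i A (rfl | hA) a ha b hb
    · have h1 := hbig i a ha
      have h2 := hbig i b hb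
      linarith [dist_triangle_right a b x₀]
    · have h1 := hC i A hA.1 a ha b hb
      linarith [le_abs_self C, abs_nonneg C]
  · rintro i A (rfl | hA) B (rfl | hB) hAB a ha b hb
    · exact absurd rfl hAB
    · rw [dist_comm]; exact hfar i B hB.1 hB.2.2 b hb a ha
    · exact hfar i A hA.1 hA.2.2 a ha b hb
    · exact hsep i A hA.1 B hB.1 hAB a ha b hb
  · rintro i A (rfl | hA)
    · exact ⟨x₀, Or.inl (Metric.mem_closedBall_self hR)⟩
    · exact hA.2.1
  · exact fun i => ⟨_, mem_insert _ _, subset_union_left⟩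

/-- The functions in `Q` separate sets from their complements of large neighbourhoods: there is a
coarsely `1`-Lipschitz function in `Q` that is `0` on the set `A`, and `c` at all points
at distance at least `B` from `A`. -/
def Separates (Q : AddSubmonoid (X → ℕ)) (c : ℕ) (B : ℝ) : Prop :=
  0 < B ∧ ∀ A : Set X, A.Nonempty → ∃ g ∈ Q, (∀ x, g x ≤ c) ∧ (∀ x ∈ A, g x = 0) ∧
    (∀ x, (∀ a ∈ A, B ≤ dist x a) → g x = c) ∧ ∀ x y, |(g x : ℝ) - g y| ≤ dist x y + 1

/-- The functions in `Q` that are constant on each of the sets in `𝒱`, with a value divisible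
by `m`. -/
def AddSubmonoid.constOn (Q : AddSubmonoid (X → ℕ)) (𝒱 : Set (Set X)) (m : ℕ) :
    AddSubmonoid (X → ℕ) where
  carrier := {g | g ∈ Q ∧ ∀ V ∈ 𝒱, ∃ c, ∀ x ∈ V, g x = m * c}
  zero_mem' := ⟨Q.zero_mem, fun _ _ => ⟨0, fun _ _ => rfl⟩⟩
  add_mem' := by
    rintro f g ⟨hf, hf'⟩ ⟨hg, hg'⟩
    refine ⟨Q.add_mem hf hg, fun V hV => ?_⟩
    obtain ⟨c, hc⟩ := hf' V hV
    obtain ⟨d, hd⟩ := hg' V hV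
    exact ⟨c + d, fun x hx => by rw [Pi.add_apply, hc x hx, hd x hx, mul_add]⟩

/-- Truncate the integer part of the distance to `A`; rounding accounts for the additive error `1`.
-/
lemma separates_top (M : ℕ) : ∃ B : ℝ, Separates (⊤ : AddSubmonoid (X → ℕ)) M B := by
  refine ⟨M + 1, by positivity, fun A hA => ⟨fun x => min M ⌊Metric.infDist x A⌋₊,
    AddSubmonoid.mem_top _, fun x => min_le_left _ _, fun x hx => ?_, fun x hx => ?_,
    fun x y => ?_⟩⟩
  · simp [Metric.infDist_zero_of_mem hx]
  · refine min_eq_left (Nat.le_floor ?_)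
    have := (Metric.le_infDist hA (x := x) (r := M + 1)).2 fun {y} hy => hx y hy
    linarith
  · have key : ∀ x y : X, ((min M ⌊Metric.infDist x A⌋₊ : ℕ) : ℝ) ≤
        (min M ⌊Metric.infDist y A⌋₊ : ℕ) + (dist x y + 1) := by
      intro x y
      push_cast
      rw [← min_add_add_right]
      have h1 := Metric.infDist_le_infDist_add_dist (s := A) (x := x) (y := y)
      have h2 := Nat.floor_le (Metric.infDist_nonneg (s := A) (x := x))
      have h3 := Nat.lt_floor_add_one (Metric.infDist y A)
      have h4 := dist_nonneg (x := x) (y := y)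
      exact le_min ((min_le_left _ _).trans (by linarith)) ((min_le_right _ _).trans (by linarith))
    have h1 := key x y
    have h2 := key y x
    rw [dist_comm y x] at h2
    rw [abs_le]
    constructor <;> linarith

/-- Separation by functions that are constant on the members of a family. -/
lemma Separates.constOn {Q : AddSubmonoid (X → ℕ)} {m : ℕ} {B C : ℝ} (hQ : Separates Q m B)
    {𝒱 : Set (Set X)} (hsep : ∀ V ∈ 𝒱, ∀ V' ∈ 𝒱, V ≠ V' → ∀ a ∈ V, ∀ b ∈ V', B ≤ dist a b)
    (hC : ∀ V ∈ 𝒱, ∀ a ∈ V, ∀ b ∈ V, dist a b ≤ C) (M : ℕ) :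
    ∃ B', Separates (Q.constOn 𝒱 m) (M * m) B' := by
  obtain ⟨hB, hQ⟩ := hQ
  -- The `j`-th summand jumps from `0` to `m` around `A₂ j`, which swallows the members of `𝒱`
  -- within `B` of `A₁ j`; so a member of `𝒱` sees only `0` or only `m`. Beyond the thickness `2 * B
  -- + |C|` of a shell, `E` leaves a gap of `M * m`. Hence for points closer than `M * m` at most
  -- one summand varies, while for all others the total range `M * m` is already a sufficient bound.
  set E : ℝ := 2 * B + |C| + M * m with hE
  have hE0 : 0 < E := by positivity
  refine ⟨M * E + 1, by positivity, fun A hA => ?_⟩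
  let A₁ : ℕ → Set X := fun j => {x | ∃ a ∈ A, dist x a ≤ j * E}
  let A₂ : ℕ → Set X := fun j => A₁ j ∪ ⋃₀ {V | V ∈ 𝒱 ∧ ∃ v ∈ V, ∃ y ∈ A₁ j, dist v y < B}
  have hA₁ : ∀ j, A ⊆ A₁ j := fun j a ha => ⟨a, ha, by rw [dist_self]; positivity⟩
  have hA₂ : ∀ j, ∀ x ∈ A₂ j, ∃ y ∈ A₁ j, dist x y ≤ B + |C| := by
    rintro j x (hx | ⟨V, ⟨hV, v, hv, y, hy, hvy⟩, hx⟩)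
    · exact ⟨x, hx, by rw [dist_self]; positivity⟩
    · refine ⟨y, hy, ?_⟩
      have h1 := hC V hV x hx v hv
      linarith [dist_triangle x v y, le_abs_self C]
  choose g hgQ hgle hg0 hgB hgL using fun j => hQ (A₂ j) (hA.mono ((hA₁ j).trans subset_union_left))
  -- the sets on which two of the functions vary are far from each other
  have hvary : ∀ x y, dist x y < M * m → ∀ i j, i < j → g i x ≠ g i y → g j x = g j y := by
    intro x y hxy i j hij hne
    have key : ∀ x y, dist x y < M * m → g i x ≠ m → g j x = 0 ∧ g j y = 0 := by
      intro x y hxy hx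
      obtain ⟨a, ha, hxa⟩ : ∃ a ∈ A₂ i, dist x a < B := by
        by_contra! h
        exact hx (hgB i x h)
      obtain ⟨b, ⟨c, hc, hbc⟩, hab⟩ := hA₂ i a ha
      have h1 : dist x c ≤ i * E + (2 * B + |C|) := by
        linarith [dist_triangle4 x a b c]
      have h2 : dist y c ≤ i * E + E := by
        have := dist_triangle_left y c x
        rw [hE]; linarith
      have h3 : (i : ℝ) * E + E ≤ j * E := by
        have : (i + 1 : ℝ) ≤ j := by exact_mod_cast hij
        nlinarith
      have h4 : (2 * B + |C|) ≤ E := by rw [hE]; linarith [show (0 : ℝ) ≤ M * m by positivity]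
      exact ⟨hg0 j x (Or.inl ⟨c, hc, by linarith⟩), hg0 j y (Or.inl ⟨c, hc, by linarith⟩)⟩
    by_cases hx : g i x = m
    · have hy : g i y ≠ m := fun hy => hne (hx.trans hy.symm)
      obtain ⟨h1, h2⟩ := key y x (by rwa [dist_comm]) hy
      rw [h1, h2]
    · obtain ⟨h1, h2⟩ := key x y hxy hx
      rw [h1, h2]
  have hgV : ∀ j, ∀ V ∈ 𝒱, (∀ x ∈ V, g j x = 0) ∨ ∀ x ∈ V, g j x = m := by
    intro j V hV
    by_cases h : ∃ v ∈ V, ∃ y ∈ A₁ j, dist v y < B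
    · exact Or.inl fun x hx => hg0 j x (Or.inr ⟨V, ⟨hV, h⟩, hx⟩)
    · right
      intro x hx
      refine hgB j x ?_
      rintro a (ha | ⟨V', ⟨hV', h'⟩, ha⟩)
      · push Not at h
        exact h x hx a ha
      · exact hsep V hV V' hV' (fun e => h (e ▸ h')) x hx a ha
  refine ⟨∑ j ∈ Finset.range M, g j, ⟨Q.sum_mem fun j _ => hgQ j, fun V hV => ?_⟩, fun x => ?_,
    fun x hx => ?_, fun x hx => ?_, fun x y => ?_⟩
  · rcases V.eq_empty_or_nonempty with rfl | ⟨v, hv⟩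
    · exact ⟨0, fun x hx => absurd hx (notMem_empty x)⟩
    have hc : ∀ j, ∃ c, ∀ x ∈ V, g j x = m * c := fun j => by
      rcases hgV j V hV with h | h
      · exact ⟨0, fun x hx => by rw [h x hx, mul_zero]⟩
      · exact ⟨1, fun x hx => by rw [h x hx, mul_one]⟩
    choose c hc using hc
    refine ⟨∑ j ∈ Finset.range M, c j, fun x hx => ?_⟩
    rw [Finset.sum_apply, Finset.mul_sum]
    exact Finset.sum_congr rfl fun j _ => hc j x hx
  · rw [Finset.sum_apply]
    exact (Finset.sum_le_card_nsmul _ _ m fun j _ => hgle j x).trans_eq (by simp)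
  · rw [Finset.sum_apply]
    exact Finset.sum_eq_zero fun j _ => hg0 j x (Or.inl (hA₁ j hx))
  · rw [Finset.sum_apply, Finset.sum_congr rfl fun j hj => hgB j x ?_]
    · simp
    · intro a ha
      obtain ⟨b, ⟨c, hc, hbc⟩, hab⟩ := hA₂ j a ha
      have h1 := hx c hc
      have h2 := dist_triangle4 x a b c
      have h3 : (j + 1 : ℝ) ≤ M := by exact_mod_cast Finset.mem_range.1 hj
      have h4 : (j + 1 : ℝ) * E ≤ M * E := by gcongr
      have h5 : 2 * B + |C| ≤ E := by rw [hE]; linarith [show (0 : ℝ) ≤ M * m by positivity]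
      linarith
  · have hle : ∀ x, (∑ j ∈ Finset.range M, g j) x ≤ M * m := fun x => by
      rw [Finset.sum_apply]
      exact (Finset.sum_le_card_nsmul _ _ m fun j _ => hgle j x).trans_eq (by simp)
    rcases lt_or_ge (dist x y) (M * m) with hxy | hxy
    · by_cases h : ∃ i ∈ Finset.range M, g i x ≠ g i y
      · obtain ⟨i, hi, hne⟩ := h
        have : ((∑ j ∈ Finset.range M, g j) x : ℝ) - ((∑ j ∈ Finset.range M, g j) y : ℕ) =
            g i x - g i y := by
          rw [Finset.sum_apply, Finset.sum_apply]
          push_cast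
          rw [← Finset.sum_sub_distrib]
          refine Finset.sum_eq_single_of_mem i hi fun j _ hj => sub_eq_zero.2 ?_
          rcases lt_or_gt_of_ne hj with h1 | h1
          · by_contra h2
            exact hne (hvary x y hxy j i h1 (by exact_mod_cast h2))
          · exact_mod_cast hvary x y hxy i j h1 hne
        rw [this]
        exact hgL i x y
      · push Not at h
        rw [Finset.sum_apply, Finset.sum_apply, Finset.sum_congr rfl h, sub_self, abs_zero]
        positivity
    · have h1 : ((∑ j ∈ Finset.range M, g j) x : ℝ) ≤ M * m := by exact_mod_cast hle x
      have h2 : ((∑ j ∈ Finset.range M, g j) y : ℝ) ≤ M * m := by exact_mod_cast hle y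
      have h3 : (0 : ℝ) ≤ ((∑ j ∈ Finset.range M, g j) x : ℕ) := Nat.cast_nonneg _
      have h4 : (0 : ℝ) ≤ ((∑ j ∈ Finset.range M, g j) y : ℕ) := Nat.cast_nonneg _
      rw [abs_le]
      constructor <;> linarith

/-- One level of a tower: a separated uniformly bounded family `sets`, and the function `depth`
that measures how far a point is from the core of the member of the family that contains it. -/
structure IsLevel (x₀ : X) (k : ℕ) (sets : Set (Set X)) (depth : X → ℕ) : Prop where
  depth_le : ∀ x, depth x ≤ 2 ^ k
  depth_lt_iff : ∀ x, depth x < 2 ^ k ↔ ∃ V ∈ sets, x ∈ V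
  nonempty : ∀ V ∈ sets, V.Nonempty
  separated : ∀ V ∈ sets, ∀ V' ∈ sets, V ≠ V' → ∀ x ∈ V, ∀ y ∈ V', 1 ≤ dist x y
  abs_depth_sub_le : ∀ x y, |(depth x : ℝ) - depth y| ≤ dist x y + 1
  le_depth_add : ∀ V ∈ sets, ∀ x ∈ V, ∀ y ∉ V, (2 : ℝ) ^ k ≤ depth x + (dist x y + 1)
  closedBall_subset : ∃ V ∈ sets, Metric.closedBall x₀ k ⊆ V
  depth_eq_zero : ∀ x ∈ Metric.closedBall x₀ k, depth x = 0

/-- The state of the construction of a tower after `k` levels: for each colour the functions that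
may still be used as depth functions, and the sets used so far. -/
structure IsTowerState {n : ℕ} (k : ℕ) (Q : Fin (n + 1) → AddSubmonoid (X → ℕ))
    (𝒲 : Fin (n + 1) → Set (Set X)) : Prop where
  separates : ∀ i (M : ℕ), ∃ B, Separates (Q i) (M * 2 ^ k) B
  bounded : ∃ C : ℝ, 0 ≤ C ∧ ∀ i, ∀ W ∈ 𝒲 i, ∀ x ∈ W, ∀ y ∈ W, dist x y ≤ C
  eq : ∀ i, ∀ W ∈ 𝒲 i, ∀ g ∈ Q i, ∀ x ∈ W, ∀ y ∈ W, g x = g y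

/-- The depth function of a colour is an admissible function separating the union of its cover
family from far away points. Its sublevel set below `2 ^ k` splits into one piece around each member
of the family, and later functions are required to be constant on these pieces. -/
lemma IsTowerState.exists_next {n : ℕ} (hX : AsdimLE X n) (x₀ : X) {k : ℕ}
    {Q : Fin (n + 1) → AddSubmonoid (X → ℕ)} {𝒲 : Fin (n + 1) → Set (Set X)}
    (h : IsTowerState k Q 𝒲) :
    ∃ (𝒱 : Fin (n + 1) → Set (Set X)) (a : Fin (n + 1) → X → ℕ),
      (∀ i, IsLevel x₀ k (𝒱 i) (a i) ∧ a i ∈ Q i ∧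
        ∀ W ∈ 𝒲 i, ∀ V ∈ 𝒱 i, (W ∩ V).Nonempty → W ⊆ V) ∧
      (∀ x, ∃ i, a i x = 0) ∧
      IsTowerState (k + 1) (fun i => (Q i).constOn (𝒱 i) (2 ^ k)) (fun i => 𝒲 i ∪ 𝒱 i) := by
  choose B' hB' using fun i => h.separates i 1
  obtain ⟨C, hC0, hC⟩ := h.bounded
  obtain ⟨B, hB⟩ : ∃ B, ∀ i, Separates (Q i) (2 ^ k) B := by
    refine ⟨∑ i, B' i, fun i => ?_⟩
    have hle : B' i ≤ ∑ i, B' i :=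
      Finset.single_le_sum (f := B') (fun j _ => (hB' j).1.le) (Finset.mem_univ i)
    refine ⟨(hB' i).1.trans_le hle, fun A hA => ?_⟩
    obtain ⟨g, h1, h2, h3, h4, h5⟩ := (hB' i).2 A hA
    rw [one_mul] at h2 h4
    exact ⟨g, h1, h2, h3, fun x hx => h4 x fun a ha => hle.trans (hx a ha), h5⟩
  have hB0 : 0 < B := (hB 0).1
  -- Passing from `U` to `V i U` costs `2 * B`. Of the remaining distance, `B` serves
  -- `Separates.constOn`, `C` prevents an earlier set from meeting two new ones, `2 ^ k` gives
  -- `le_depth_add`, and `1` gives `separated`.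
  obtain ⟨𝒰, hcov, ⟨C', hC'0, hC'⟩, hsep, hne, hball⟩ := hX.exists_cover x₀
    (D := 3 * B + C + 2 ^ k + 1) (R := k) (by positivity) (by positivity)
  choose b hb hbsub using hball
  choose a haQ hale ha0 haB haL using fun i => (hB i).2 (⋃₀ 𝒰 i)
    ⟨x₀, b i, hb i, hbsub i (Metric.mem_closedBall_self (by positivity))⟩
  let V : Fin (n + 1) → Set X → Set X := fun i U => {x | a i x < 2 ^ k ∧ ∃ u ∈ U, dist x u < B}
  have hUV : ∀ i, ∀ U ∈ 𝒰 i, U ⊆ V i U := fun i U hU x hx =>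
    ⟨by rw [ha0 i x ⟨U, hU, hx⟩]; positivity, x, hx, by rwa [dist_self]⟩
  have hVsep : ∀ i, ∀ U ∈ 𝒰 i, ∀ U' ∈ 𝒰 i, U ≠ U' → ∀ x ∈ V i U, ∀ y ∈ V i U',
      B + C + 2 ^ k + 1 ≤ dist x y := by
    rintro i U hU U' hU' hUU x ⟨-, u, hu, hxu⟩ y ⟨-, u', hu', hyu⟩
    have h1 := hsep i U hU U' hU' hUU u hu u' hu'
    have h2 := dist_triangle4 u x y u'
    rw [dist_comm u x] at h2
    linarith
  have hVbdd : ∀ i, ∀ U ∈ 𝒰 i, ∀ x ∈ V i U, ∀ y ∈ V i U, dist x y ≤ C' + 2 * B := by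
    rintro i U hU x ⟨-, u, hu, hxu⟩ y ⟨-, u', hu', hyu⟩
    have h1 := hC' i U hU u hu u' hu'
    have h2 := dist_triangle4 x u u' y
    rw [dist_comm u' y] at h2
    linarith
  have hVcov : ∀ i x, a i x < 2 ^ k → ∃ U ∈ 𝒰 i, x ∈ V i U := by
    intro i x hx
    by_contra! hcon
    refine hx.ne (haB i x ?_)
    rintro u ⟨U, hU, hu⟩
    by_contra hlt
    exact hcon U hU ⟨hx, u, hu, not_le.1 hlt⟩
  have hpow : (0 : ℝ) < 2 ^ k := by positivity
  have hsep' : ∀ i, ∀ W ∈ V i '' 𝒰 i, ∀ W' ∈ V i '' 𝒰 i, W ≠ W' → ∀ x ∈ W, ∀ y ∈ W',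
      B + C + 2 ^ k + 1 ≤ dist x y := by
    rintro i _ ⟨U, hU, rfl⟩ _ ⟨U', hU', rfl⟩ hne x hx y hy
    exact hVsep i U hU U' hU' (fun e => hne (by rw [e])) x hx y hy
  have hbdd' : ∀ i, ∀ W ∈ V i '' 𝒰 i, ∀ x ∈ W, ∀ y ∈ W, dist x y ≤ C' + 2 * B := by
    rintro i _ ⟨U, hU, rfl⟩
    exact hVbdd i U hU
  have hlt : ∀ i, ∀ W ∈ V i '' 𝒰 i, ∀ x ∈ W, a i x < 2 ^ k := by
    rintro i _ ⟨U, hU, rfl⟩ x hx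
    exact hx.1
  have hcov' : ∀ i x, a i x < 2 ^ k → ∃ W ∈ V i '' 𝒰 i, x ∈ W := by
    intro i x hx
    obtain ⟨U, hU, hxU⟩ := hVcov i x hx
    exact ⟨_, ⟨U, hU, rfl⟩, hxU⟩
  refine ⟨fun i => V i '' 𝒰 i, a, fun i => ⟨⟨hale i, ?_, ?_, ?_, haL i, ?_, ?_, ?_⟩, haQ i, ?_⟩,
    ?_, ⟨?_, ?_, ?_⟩⟩
  · exact fun x => ⟨hcov' i x, fun ⟨W, hW, hx⟩ => hlt i W hW x hx⟩
  · rintro _ ⟨U, hU, rfl⟩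
    exact (hne i U hU).mono (hUV i U hU)
  · intro W hW W' hW' hWW x hx y hy
    linarith [hsep' i W hW W' hW' hWW x hx y hy]
  · intro W hW x hx y hy
    rcases (hale i y).lt_or_eq with hy' | hy'
    · obtain ⟨W', hW', hyW⟩ := hcov' i y hy'
      have h1 := hsep' i W hW W' hW' (fun e => hy (e ▸ hyW)) x hx y hyW
      have h2 : (0 : ℝ) ≤ a i x := Nat.cast_nonneg _
      linarith
    · have h1 := (abs_le.1 (haL i x y)).1
      rw [hy'] at h1
      push_cast at h1
      linarith
  · exact ⟨_, ⟨b i, hb i, rfl⟩, (hbsub i).trans (hUV i _ (hb i))⟩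
  · exact fun x hx => ha0 i x ⟨b i, hb i, hbsub i hx⟩
  · intro W hW W' hW' ⟨w, hw, hw'⟩ x hx
    -- The depth is constant on `W`, so all of `W` lies in the new family; being of diameter at most
    -- `C`, it cannot meet two members.
    have h1 : a i x = a i w := h.eq i W hW _ (haQ i) x hx w hw
    obtain ⟨W'', hW'', hx''⟩ := hcov' i x (h1 ▸ hlt i W' hW' w hw')
    by_cases e : W'' = W'
    · exact e ▸ hx''
    · have h2 := hsep' i W'' hW'' W' hW' e x hx'' w hw'
      have h3 := hC i W hW x hx w hw
      linarith
  · intro x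
    obtain ⟨i, U, hU, hx⟩ := hcov x
    exact ⟨i, ha0 i x ⟨U, hU, hx⟩⟩
  · intro i M
    obtain ⟨B'', hB''⟩ := (hB i).constOn (𝒱 := V i '' 𝒰 i)
      (fun W hW W' hW' hWW x hx y hy => by linarith [hsep' i W hW W' hW' hWW x hx y hy])
      (hbdd' i) (M * 2)
    exact ⟨B'', by rwa [pow_succ', ← mul_assoc]⟩
  · refine ⟨C + (C' + 2 * B), by positivity, ?_⟩
    rintro i W (hW | hW) x hx y hy
    · linarith [hC i W hW x hx y hy]
    · linarith [hbdd' i W hW x hx y hy]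
  · rintro i W (hW | hW) g ⟨hg, hg'⟩ x hx y hy
    · exact h.eq i W hW g hg x hx y hy
    · obtain ⟨c, hc⟩ := hg' W hW
      rw [hc x hx, hc y hy]

/-- A sequence of uniformly bounded separated families such that the members of each family are,
from the point of view of the later families, single points. -/
structure Tower (x₀ : X) where
  sets : ℕ → Set (Set X)
  depth : ℕ → X → ℕ
  isLevel : ∀ k, IsLevel x₀ k (sets k) (depth k)
  exists_depth_eq : ∀ {l k}, l < k → ∀ V ∈ sets l, ∃ c, ∀ x ∈ V, depth k x = 2 ^ l * c
  subset : ∀ {l k}, l < k → ∀ V ∈ sets l, ∀ V' ∈ sets k, (V ∩ V').Nonempty → V ⊆ V'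
  exists_bound : ∀ k, ∃ C : ℝ, ∀ V ∈ sets k, ∀ x ∈ V, ∀ y ∈ V, dist x y ≤ C

/-- The admissible functions decrease and the recorded sets increase along the recursion, so each
depth function obeys the conditions imposed by all earlier families. -/
theorem AsdimLE.exists_tower {n : ℕ} (hX : AsdimLE X n) (x₀ : X) :
    ∃ τ : Fin (n + 1) → Tower x₀, ∀ k x, ∃ i, (τ i).depth k x = 0 := by
  let State (k : ℕ) : Type u := {s : (Fin (n + 1) → AddSubmonoid (X → ℕ)) ×
    (Fin (n + 1) → Set (Set X)) // IsTowerState k s.1 s.2}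
  let s₀ : State 0 := ⟨(fun _ => ⊤, fun _ => ∅), fun _ M => by
      rw [pow_zero, mul_one]; exact separates_top M, ⟨0, le_rfl, fun _ _ h => h.elim⟩,
    fun _ _ h => h.elim⟩
  choose 𝒱 a hlev hzero hnext using fun k (s : State k) => s.2.exists_next hX x₀
  let s : ∀ k, State k := fun k => Nat.rec s₀ (fun k s =>
    ⟨(fun i => (s.1.1 i).constOn (𝒱 k s i) (2 ^ k), fun i => s.1.2 i ∪ 𝒱 k s i), hnext k s⟩) k
  have hQ : ∀ i {l k}, l ≤ k → (s k).1.1 i ≤ (s l).1.1 i := by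
    intro i l k hlk
    induction hlk with
    | refl => exact le_rfl
    | step _ ih => exact le_trans (fun g hg => hg.1) ih
  have hW : ∀ i {l k}, l ≤ k → (s l).1.2 i ⊆ (s k).1.2 i := by
    intro i l k hlk
    induction hlk with
    | refl => exact Subset.rfl
    | step _ ih => exact ih.trans subset_union_left
  refine ⟨fun i => ⟨fun k => 𝒱 k (s k) i, fun k => a k (s k) i, fun k => (hlev k (s k) i).1,
    fun {l k} hlk V hV => ?_, fun {l k} hlk V hV V' hV' hVV => ?_, fun k => ?_⟩,
    fun k x => hzero k (s k) x⟩
  · exact (hQ i (Nat.succ_le_of_lt hlk) (hlev k (s k) i).2.1).2 V hV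
  · exact (hlev k (s k) i).2.2 V (hW i (Nat.succ_le_of_lt hlk) (Or.inr hV)) V' hV' hVV
  · obtain ⟨C, -, hC⟩ := (hnext k (s k)).bounded
    exact ⟨C, fun V hV => hC i V (Or.inr hV)⟩

end Towers

/-! ### The tree of a tower. -/

namespace Tower

variable {X : Type u} [MetricSpace X] {x₀ : X} (τ : Tower x₀)

lemma eq_of_mem {k : ℕ} {V V' : Set X} (hV : V ∈ τ.sets k) (hV' : V' ∈ τ.sets k) {x : X}
    (hx : x ∈ V) (hx' : x ∈ V') : V = V' := by
  by_contra h
  have := (τ.isLevel k).separated V hV V' hV' h x hx x hx'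
  rw [dist_self] at this
  linarith

lemma depth_lt_of_mem {k : ℕ} {V : Set X} (hV : V ∈ τ.sets k) {x : X} (hx : x ∈ V) :
    τ.depth k x < 2 ^ k := ((τ.isLevel k).depth_lt_iff x).2 ⟨V, hV, hx⟩

lemma depth_eq_of_mem {l k : ℕ} (hlk : l < k) {V : Set X} (hV : V ∈ τ.sets l) {x y : X}
    (hx : x ∈ V) (hy : y ∈ V) : τ.depth k x = τ.depth k y := by
  obtain ⟨c, hc⟩ := τ.exists_depth_eq hlk V hV
  rw [hc x hx, hc y hy]

lemma depth_eq_zero {k : ℕ} {x : X} (h : dist x x₀ ≤ k) : τ.depth k x = 0 :=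
  (τ.isLevel k).depth_eq_zero x h

/-- The sum of the depths of a point in the levels from `k` on. -/
noncomputable def tail (k : ℕ) (x : X) : ℕ := ∑ j ∈ Finset.Ico k ⌈dist x x₀⌉₊, τ.depth j x

lemma tail_eq_sum (k : ℕ) {x : X} {M : ℕ} (hM : dist x x₀ ≤ M) :
    τ.tail k x = ∑ j ∈ Finset.Ico k M, τ.depth j x := by
  refine Finset.sum_subset (Finset.Ico_subset_Ico_right (Nat.ceil_le.2 hM)) fun j hj hj' => ?_
  rw [Finset.mem_Ico] at hj hj'
  exact τ.depth_eq_zero ((Nat.le_ceil _).trans (by exact_mod_cast (by omega)))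

lemma tail_eq_add (k : ℕ) (x : X) : τ.tail k x = τ.depth k x + τ.tail (k + 1) x := by
  have hM : dist x x₀ ≤ (max (k + 1) ⌈dist x x₀⌉₊ : ℕ) :=
    (Nat.le_ceil _).trans (by exact_mod_cast le_max_right _ _)
  rw [τ.tail_eq_sum k hM, τ.tail_eq_sum (k + 1) hM, Finset.sum_eq_sum_Ico_succ_bot]
  exact lt_of_lt_of_le (Nat.lt_succ_self k) (le_max_left _ _)

/-- This makes the height of an edge independent of the chosen point of its member. -/
lemma tail_eq_of_mem {l : ℕ} {V : Set X} (hV : V ∈ τ.sets l) {x y : X} (hx : x ∈ V) (hy : y ∈ V) :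
    τ.tail (l + 1) x = τ.tail (l + 1) y := by
  have hx' : dist x x₀ ≤ (max ⌈dist x x₀⌉₊ ⌈dist y x₀⌉₊ : ℕ) :=
    (Nat.le_ceil _).trans (by exact_mod_cast le_max_left _ _)
  have hy' : dist y x₀ ≤ (max ⌈dist x x₀⌉₊ ⌈dist y x₀⌉₊ : ℕ) :=
    (Nat.le_ceil _).trans (by exact_mod_cast le_max_right _ _)
  rw [τ.tail_eq_sum _ hx', τ.tail_eq_sum _ hy']
  refine Finset.sum_congr rfl fun j hj => τ.depth_eq_of_mem ?_ hV hx hy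
  have := (Finset.mem_Ico.1 hj).1
  omega

/-- The height at which the ray of `x` enters the level `k`. -/
noncomputable def entry (k : ℕ) (x : X) : ℕ := 2 ^ k + τ.tail k x

/-- At level `k` the ray climbs by `2 ^ k - depth k x`. Outside the family the depth is `2 ^ k` and
the ray does not climb at all. -/
lemma entry_add (k : ℕ) (x : X) : τ.entry k x + 2 ^ k = τ.entry (k + 1) x + τ.depth k x := by
  unfold entry
  rw [τ.tail_eq_add k x]
  ring

lemma entry_mono (x : X) : Monotone fun k => τ.entry k x := by
  refine monotone_nat_of_le_succ fun k => ?_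
  have h1 := τ.entry_add k x
  have h2 := (τ.isLevel k).depth_le x
  omega

lemma entry_eq {m k : ℕ} (hmk : m ≤ k) {x : X}
    (h : ∀ j, m ≤ j → j < k → ¬ τ.depth j x < 2 ^ j) : τ.entry m x = τ.entry k x := by
  induction k, hmk using Nat.le_induction with
  | base => rfl
  | succ k hk ih =>
    rw [ih fun j h1 h2 => h j h1 (h2.trans (Nat.lt_succ_self k))]
    have h1 := τ.entry_add k x
    have h2 := (τ.isLevel k).depth_le x
    have h3 := h k hk (Nat.lt_succ_self k)
    omega

/-- The members of the families of a tower. -/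
abbrev Cell : Type u := {e : ℕ × Set X // e.2 ∈ τ.sets e.1}

variable {τ}

/-- A point of a member of a tower. -/
noncomputable def rep (e : τ.Cell) : X := ((τ.isLevel e.1.1).nonempty e.1.2 e.2).some

lemma rep_mem (e : τ.Cell) : rep e ∈ e.1.2 := ((τ.isLevel e.1.1).nonempty e.1.2 e.2).some_mem

lemma cell_eq_of_mem {e e' : τ.Cell} (h : e.1.1 = e'.1.1) {x : X} (hx : x ∈ e.1.2)
    (hx' : x ∈ e'.1.2) : e = e' :=
  Subtype.ext (Prod.ext h (τ.eq_of_mem e.2 (h ▸ e'.2) hx hx'))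

lemma exists_parent (e : τ.Cell) : ∃ k, e.1.1 < k ∧ τ.depth k (rep e) < 2 ^ k := by
  refine ⟨max (e.1.1 + 1) ⌈dist (rep e) x₀⌉₊, lt_of_lt_of_le (Nat.lt_succ_self _) (le_max_left _ _),
    ?_⟩
  rw [τ.depth_eq_zero ((Nat.le_ceil _).trans (by exact_mod_cast le_max_right _ _))]
  positivity

open Classical in
/-- The level of the next larger member of a tower. -/
noncomputable def parentLevel (e : τ.Cell) : ℕ := Nat.find (exists_parent e)

lemma lt_parentLevel (e : τ.Cell) : e.1.1 < parentLevel e := by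
  classical exact (Nat.find_spec (exists_parent e)).1

lemma depth_parentLevel_lt (e : τ.Cell) :
    τ.depth (parentLevel e) (rep e) < 2 ^ parentLevel e := by
  classical exact (Nat.find_spec (exists_parent e)).2

/-- The next larger member of a tower. -/
noncomputable def parent (e : τ.Cell) : τ.Cell :=
  ⟨(parentLevel e, (((τ.isLevel _).depth_lt_iff _).1 (depth_parentLevel_lt e)).choose),
    (((τ.isLevel _).depth_lt_iff _).1 (depth_parentLevel_lt e)).choose_spec.1⟩

lemma rep_mem_parent (e : τ.Cell) : rep e ∈ (parent e).1.2 :=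
  (((τ.isLevel _).depth_lt_iff _).1 (depth_parentLevel_lt e)).choose_spec.2

lemma subset_parent (e : τ.Cell) : e.1.2 ⊆ (parent e).1.2 :=
  τ.subset (lt_parentLevel e) _ e.2 _ (parent e).2 ⟨rep e, rep_mem e, rep_mem_parent e⟩

lemma not_depth_lt {e : τ.Cell} {x : X} (hx : x ∈ e.1.2) {j : ℕ} (h1 : e.1.1 + 1 ≤ j)
    (h2 : j < parentLevel e) : ¬ τ.depth j x < 2 ^ j := by
  classical
  rw [τ.depth_eq_of_mem h1 e.2 hx (rep_mem e)]
  exact fun h3 => Nat.find_min (exists_parent e) h2 ⟨h1, h3⟩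

lemma parentLevel_le {e e' : τ.Cell} {x : X} (hx : x ∈ e.1.2) (hx' : x ∈ e'.1.2)
    (h : e.1.1 < e'.1.1) : parentLevel e ≤ e'.1.1 := by
  by_contra hlt
  exact not_depth_lt hx h (not_le.1 hlt) (τ.depth_lt_of_mem e'.2 hx')

/-- The members containing a point form a chain in which `parent` is the successor. -/
lemma exists_iterate_parent {e e' : τ.Cell} {x : X} (hx : x ∈ e.1.2) (hx' : x ∈ e'.1.2)
    (h : e.1.1 ≤ e'.1.1) : ∃ n, parent^[n] e = e' := by
  induction hd : e'.1.1 - e.1.1 using Nat.strong_induction_on generalizing e with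
  | _ d ih =>
    rcases h.eq_or_lt with h | h
    · exact ⟨0, cell_eq_of_mem h hx hx'⟩
    · have h1 := parentLevel_le hx hx' h
      have h2 := lt_parentLevel e
      obtain ⟨n, hn⟩ := ih (e'.1.1 - parentLevel e) (by omega) (e := parent e)
        (subset_parent e hx) h1 rfl
      exact ⟨n + 1, hn⟩

lemma entry_succ_eq_entry_parentLevel {e : τ.Cell} {x : X} (hx : x ∈ e.1.2) :
    τ.entry (e.1.1 + 1) x = τ.entry (parentLevel e) x :=
  τ.entry_eq (lt_parentLevel e) fun _ h1 h2 => not_depth_lt hx h1 h2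

/-- Members of one level are at least `1` apart, so their representatives have different nearby
points in a finite `1 / 2`-net; such a net exists as `X` is proper. This gives local finiteness. -/
lemma finite_cells [ProperSpace X] (e : τ.Cell) :
    {c : τ.Cell | c.1.1 < e.1.1 ∧ c.1.2 ⊆ e.1.2}.Finite := by
  obtain ⟨C, hC⟩ := τ.exists_bound e.1.1
  have hb : Bornology.IsBounded e.1.2 :=
    Metric.isBounded_iff.2 ⟨C, fun x hx y hy => hC e.1.2 e.2 x hx y hy⟩
  have htb : TotallyBounded e.1.2 := hb.isCompact_closure.totallyBounded.subset subset_closure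
  obtain ⟨t, ht, hcov⟩ := Metric.totallyBounded_iff.1 htb (1 / 2) (by norm_num)
  have hex : ∀ c : τ.Cell, ∃ y, c.1.2 ⊆ e.1.2 → y ∈ t ∧ dist (rep c) y < 1 / 2 := by
    intro c
    by_cases hc : c.1.2 ⊆ e.1.2
    · have := hcov (hc (rep_mem c))
      simp only [mem_iUnion, Metric.mem_ball, exists_prop] at this
      obtain ⟨y, hy⟩ := this
      exact ⟨y, fun _ => hy⟩
    · exact ⟨x₀, fun h => absurd h hc⟩
  choose y hy using hex
  refine Set.Finite.of_injOn (f := fun c : τ.Cell => (c.1.1, y c)) (t := Iio e.1.1 ×ˢ t) ?_ ?_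
    ((finite_Iio _).prod ht)
  · exact fun c hc => ⟨hc.1, (hy c hc.2).1⟩
  · rintro ⟨⟨k, V⟩, hV⟩ hc ⟨⟨k', V'⟩, hV'⟩ hc' h
    obtain ⟨h1, h2⟩ := Prod.ext_iff.1 h
    change k = k' at h1
    subst h1
    have d1 := (hy _ hc.2).2
    have d2 := (hy _ hc'.2).2
    have h2' : y ⟨(k, V), hV⟩ = y ⟨(k, V'), hV'⟩ := h2
    rw [← h2'] at d2
    have hVV : V = V' := by
      by_contra hne
      have := (τ.isLevel k).separated V hV V' hV' hne _ (rep_mem ⟨(k, V), hV⟩) _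
        (rep_mem ⟨(k, V'), hV'⟩)
      linarith [dist_triangle_right (rep (⟨(k, V), hV⟩ : τ.Cell)) (rep (⟨(k, V'), hV'⟩ : τ.Cell))
        (y ⟨(k, V), hV⟩)]
    subst hVV
    rfl

variable (τ)

lemma exists_cell (k : ℕ) :
    ∃ V ∈ τ.sets k, ∀ y, dist y x₀ ≤ k → y ∈ V := by
  obtain ⟨V, hV, h⟩ := (τ.isLevel k).closedBall_subset
  exact ⟨V, hV, fun y hy => h hy⟩

/-- The tree of a tower. -/
noncomputable def edgeTree [ProperSpace X] : EdgeTree τ.Cell where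
  lev e := e.1.1
  par := parent
  off e := τ.depth (parentLevel e) (rep e)
  -- With the summand `2 ^ k`, the upper end of an edge of level `k` has height `2 ^ (k + 1)` plus
  -- the same tail, which is the entry height of level `k + 1`.
  base e := 2 ^ e.1.1 + τ.tail (e.1.1 + 1) (rep e)
  lev_lt := lt_parentLevel
  off_lt := depth_parentLevel_lt
  dvd_off e := by
    obtain ⟨c, hc⟩ := τ.exists_depth_eq (lt_parentLevel e) _ e.2
    rw [hc _ (rep_mem e)]
    exact dvd_mul_right _ _
  base_par e := by
    have h1 := entry_succ_eq_entry_parentLevel (rep_mem e)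
    rw [entry, entry, τ.tail_eq_add (parentLevel e)] at h1
    rw [τ.tail_eq_of_mem (parent e).2 (rep_mem _) (rep_mem_parent e)]
    change (2 : ℤ) ^ parentLevel e + τ.tail (parentLevel e + 1) (rep e) +
      τ.depth (parentLevel e) (rep e) = _
    have h2 : (2 : ℤ) ^ (e.1.1 + 1) + τ.tail (e.1.1 + 1) (rep e) = 2 ^ parentLevel e +
      (τ.depth (parentLevel e) (rep e) + τ.tail (parentLevel e + 1) (rep e)) := by
      exact_mod_cast h1
    rw [pow_succ] at h2
    linarith
  directed e e' := by
    let K := max (max e.1.1 e'.1.1) (max ⌈dist (rep e) x₀⌉₊ ⌈dist (rep e') x₀⌉₊)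
    have h1 : dist (rep e) x₀ ≤ (K : ℕ) := (Nat.le_ceil _).trans
      (by exact_mod_cast (le_max_left _ _).trans (le_max_right _ _))
    have h2 : dist (rep e') x₀ ≤ (K : ℕ) := (Nat.le_ceil _).trans
      (by exact_mod_cast (le_max_right _ _).trans (le_max_right _ _))
    obtain ⟨V, hV, h⟩ := τ.exists_cell K
    obtain ⟨m, hm⟩ := exists_iterate_parent (e := e) (e' := ⟨(K, V), hV⟩) (rep_mem e) (h _ h1)
      ((le_max_left _ _).trans (le_max_left _ _))
    obtain ⟨n, hn⟩ := exists_iterate_parent (e := e') (e' := ⟨(K, V), hV⟩) (rep_mem e') (h _ h2)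
      ((le_max_right _ _).trans (le_max_left _ _))
    exact ⟨m, n, hm.trans hn.symm⟩
  finite_children e := by
    refine (finite_cells e).subset ?_
    rintro c rfl
    exact ⟨lt_parentLevel c, subset_parent c⟩

end Tower

namespace EdgeTree

variable {E : Type*} (𝓔 : EdgeTree E)

lemma edgeAt_decorate (e : E) (t : ℝ) :
    𝓔.decorate.edgeAt (Sum.inl e) t = Sum.inl (𝓔.edgeAt e t) := by
  induction e using 𝓔.ray_induction t with
  | h0 e h => rw [𝓔.edgeAt_of_lt h, 𝓔.decorate.edgeAt_of_lt (e := Sum.inl e) h]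
  | h1 e h ih => rw [𝓔.edgeAt_of_le h, 𝓔.decorate.edgeAt_of_le (e := Sum.inl e) h, ← ih]; rfl

end EdgeTree

/-! ### The map to the tree and its distance estimates. -/

namespace Tower

variable {X : Type u} [MetricSpace X] [ProperSpace X] {x₀ : X} (τ : Tower x₀)

lemma base_eq (e : τ.Cell) {x : X} (hx : x ∈ e.1.2) :
    (τ.edgeTree.base e : ℝ) + τ.depth e.1.1 x = τ.entry e.1.1 x := by
  have h1 : τ.edgeTree.base e = 2 ^ e.1.1 + τ.tail (e.1.1 + 1) x := by
    rw [τ.tail_eq_of_mem e.2 hx (rep_mem e)]; rfl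
  rw [h1, entry, τ.tail_eq_add e.1.1]
  push_cast
  ring

lemma top_eq (e : τ.Cell) {x : X} (hx : x ∈ e.1.2) :
    (τ.edgeTree.top e : ℝ) = τ.entry (e.1.1 + 1) x := by
  have h1 := τ.base_eq e hx
  have h2 : (τ.entry e.1.1 x : ℝ) + 2 ^ e.1.1 = τ.entry (e.1.1 + 1) x + τ.depth e.1.1 x := by
    exact_mod_cast τ.entry_add e.1.1 x
  rw [EdgeTree.top]
  push_cast
  change (τ.edgeTree.base e : ℝ) + 2 ^ e.1.1 = _
  linarith

lemma entry_lt_top (e : τ.Cell) {x : X} (hx : x ∈ e.1.2) :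
    (τ.entry e.1.1 x : ℝ) < τ.edgeTree.top e := by
  rw [τ.top_eq e hx]
  have h1 := τ.entry_add e.1.1 x
  have h2 := τ.depth_lt_of_mem e.2 hx
  exact_mod_cast (by omega)

/-- The ray of `x` traverses the members of the tower that contain `x`. -/
lemma edgeAt_entry {e e' : τ.Cell} {x : X} (hx : x ∈ e.1.2) (hx' : x ∈ e'.1.2)
    (h : e.1.1 ≤ e'.1.1) : τ.edgeTree.edgeAt e (τ.entry e'.1.1 x) = e' := by
  induction hd : e'.1.1 - e.1.1 using Nat.strong_induction_on generalizing e with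
  | _ d ih =>
    rcases h.eq_or_lt with h | h
    · obtain rfl := cell_eq_of_mem h hx hx'
      exact EdgeTree.edgeAt_of_lt _ (τ.entry_lt_top _ hx)
    · have h1 := parentLevel_le hx hx' h
      have h2 := lt_parentLevel e
      rw [EdgeTree.edgeAt_of_le]
      · exact ih (e'.1.1 - parentLevel e) (by omega) (e := parent e) (subset_parent e hx) h1 rfl
      · rw [τ.top_eq e hx]
        exact_mod_cast τ.entry_mono x h

lemma subset_edgeAt (e : τ.Cell) (t : ℝ) : e.1.2 ⊆ (τ.edgeTree.edgeAt e t).1.2 := by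
  induction e using τ.edgeTree.ray_induction t with
  | h0 e h => rw [EdgeTree.edgeAt_of_lt _ h]
  | h1 e h ih =>
    rw [EdgeTree.edgeAt_of_le _ h]
    exact (subset_parent e).trans ih

omit [ProperSpace X] in
/-- The smallest member of a tower that contains a given point. -/
lemma exists_minimal_cell (x : X) : ∃ e : τ.Cell, x ∈ e.1.2 ∧
    ∀ e' : τ.Cell, x ∈ e'.1.2 → e.1.1 ≤ e'.1.1 := by
  classical
  have hex : ∃ k, ∃ V ∈ τ.sets k, x ∈ V := by
    obtain ⟨V, hV, h⟩ := τ.exists_cell ⌈dist x x₀⌉₊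
    exact ⟨_, V, hV, h x (Nat.le_ceil _)⟩
  obtain ⟨V, hV, hx⟩ := Nat.find_spec hex
  exact ⟨⟨(_, V), hV⟩, hx, fun e' he' => Nat.find_min' hex ⟨e'.1.2, e'.2, he'⟩⟩

/-- The map of `X` to the tree. -/
noncomputable def toTree (x : X) : τ.edgeTree.decorate.Point where
  edge := Sum.inl (τ.exists_minimal_cell x).choose
  ht := τ.entry (τ.exists_minimal_cell x).choose.1.1 x
  base_le := by
    have := τ.base_eq _ (τ.exists_minimal_cell x).choose_spec.1
    rw [← this]
    exact le_add_of_nonneg_right (Nat.cast_nonneg _)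
  lt_top := τ.entry_lt_top _ (τ.exists_minimal_cell x).choose_spec.1

/-- Below the smallest member containing `x` there is no climb, so the entry height is constant
there. -/
lemma ht_toTree (x : X) : (τ.toTree x).ht = τ.entry 0 x := by
  obtain ⟨h1, h2⟩ := (τ.exists_minimal_cell x).choose_spec
  have : τ.entry 0 x = τ.entry (τ.exists_minimal_cell x).choose.1.1 x := by
    refine τ.entry_eq (Nat.zero_le _) fun j _ hj hlt => ?_
    obtain ⟨V, hV, hx⟩ := ((τ.isLevel j).depth_lt_iff x).1 hlt
    exact absurd (h2 ⟨(j, V), hV⟩ hx) (not_le.2 hj)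
  rw [this]
  rfl

lemma ht_toTree_le (k : ℕ) (x : X) : (τ.toTree x).ht ≤ τ.entry k x := by
  rw [ht_toTree]
  exact_mod_cast τ.entry_mono x (Nat.zero_le k)

lemma edge_up_toTree {e : τ.Cell} {x : X} (hx : x ∈ e.1.2) {t : ℝ} (h1 : τ.entry e.1.1 x ≤ t)
    (h2 : t < τ.edgeTree.top e) :
    (τ.edgeTree.decorate.heightTree.up (τ.toTree x) t).edge = Sum.inl e := by
  obtain ⟨h3, h4⟩ := (τ.exists_minimal_cell x).choose_spec
  rw [EdgeTree.edge_up, max_eq_right ((τ.ht_toTree_le _ x).trans h1)]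
  change τ.edgeTree.decorate.edgeAt (Sum.inl (τ.exists_minimal_cell x).choose) t = _
  rw [EdgeTree.edgeAt_decorate, ← EdgeTree.edgeAt_edgeAt _ _ h1, τ.edgeAt_entry h3 hx (h4 e hx),
    EdgeTree.edgeAt_of_lt _ h2]

lemma mem_of_edge_up_toTree {e : τ.Cell} {y : X} {t : ℝ}
    (h : (τ.edgeTree.decorate.heightTree.up (τ.toTree y) t).edge = Sum.inl e) : y ∈ e.1.2 := by
  have h3 := (τ.exists_minimal_cell y).choose_spec.1
  rw [EdgeTree.edge_up] at h
  change τ.edgeTree.decorate.edgeAt (Sum.inl (τ.exists_minimal_cell y).choose) _ = _ at h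
  rw [EdgeTree.edgeAt_decorate] at h
  rw [← Sum.inl_injective h]
  exact τ.subset_edgeAt _ _ h3

omit [ProperSpace X] in
/-- Before the level at which `x` and a point at distance `D - 1` are contained in the same member
of the tower, the ray of `x` rises by at most `3 * D`. -/
lemma entry_le {x : X} {D : ℝ} {N : ℕ}
    (h : ∀ j < N, τ.depth j x < 2 ^ j → (2 : ℝ) ^ j ≤ τ.depth j x + D) (hD : 0 ≤ D) :
    (τ.entry N x : ℝ) ≤ τ.entry 0 x + 3 * D := by
  -- Here `j` is the last level below `M` at which the ray climbs. All climbs up to that level add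
  -- up to less than `2 * 2 ^ j`.
  have key : ∀ M ≤ N, (τ.entry M x = τ.entry 0 x) ∨ ∃ j < M, τ.depth j x < 2 ^ j ∧
      τ.entry M x < τ.entry 0 x + 2 * 2 ^ j ∧ (τ.entry M x : ℝ) ≤ τ.entry 0 x + 3 * D := by
    intro M
    induction M with
    | zero => exact fun _ => Or.inl rfl
    | succ M ih =>
      intro hM
      have e1 := τ.entry_add M x
      rcases ((τ.isLevel M).depth_le x).eq_or_lt with hd | hd
      · have e2 : τ.entry (M + 1) x = τ.entry M x := by omega
        rw [e2]
        refine (ih (by omega)).imp_right ?_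
        rintro ⟨j, hj, h'⟩
        exact ⟨j, by omega, h'⟩
      · right
        have h1 := h M (by omega) hd
        have e2 : (τ.entry M x : ℝ) + 2 ^ M = τ.entry (M + 1) x + τ.depth M x := by exact_mod_cast e1
        have e3 : τ.entry M x < τ.entry 0 x + 2 ^ M := by
          have h2 : τ.entry M x + ∑ j ∈ Finset.range M, τ.depth j x + 1 = τ.entry 0 x + 2 ^ M := by
            clear * -
            induction M with
            | zero => simp
            | succ M ih =>
              rw [Finset.sum_range_succ, pow_succ]
              have := τ.entry_add M x
              omega
          omega
        refine ⟨M, Nat.lt_succ_self M, hd, by omega, ?_⟩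
        rcases ih (by omega) with h2 | ⟨j, hj, h2, h3, -⟩
        · rw [h2] at e2
          linarith
        · obtain ⟨V, hV, hx⟩ := ((τ.isLevel j).depth_lt_iff x).1 h2
          obtain ⟨c, hc⟩ := τ.exists_depth_eq hj V hV
          -- Both `depth M x` and `2 ^ M` are multiples of `2 ^ j`, so the climb at level `M` is at
          -- least `2 ^ j`. It is at most `D`, whence the total is at most `2 * 2 ^ j + D ≤ 3 * D`.
          have h4 : τ.depth M x + 2 ^ j ≤ 2 ^ M := by
            obtain ⟨m, rfl⟩ := Nat.exists_eq_add_of_lt hj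
            rw [hc x hx, add_assoc, pow_add] at hd ⊢
            have := Nat.lt_of_mul_lt_mul_left hd
            nlinarith [pow_pos (zero_lt_two (α := ℕ)) j]
          have h5 : (τ.depth M x : ℝ) + 2 ^ j ≤ 2 ^ M := by exact_mod_cast h4
          have h6 : (τ.entry M x : ℝ) < τ.entry 0 x + 2 * 2 ^ j := by exact_mod_cast h3
          linarith
  rcases key N le_rfl with h1 | ⟨j, -, -, -, h1⟩
  · rw [h1]; linarith
  · exact h1

/-- Let `N` be the first level at which one member contains both points. The rays have merged at the
higher of the two entries into its edge, the climbs before are bounded by `entry_le`, and the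
entries differ as the depths do. -/
theorem dist_toTree_le (x y : X) : dist (τ.toTree x) (τ.toTree y) ≤ 7 * (dist x y + 1) := by
  classical
  have hD : 0 ≤ dist x y + 1 := by positivity
  have hex : ∃ k, ∃ V ∈ τ.sets k, x ∈ V ∧ y ∈ V := by
    have h1 : dist x x₀ ≤ (max ⌈dist x x₀⌉₊ ⌈dist y x₀⌉₊ : ℕ) :=
      (Nat.le_ceil _).trans (by exact_mod_cast le_max_left _ _)
    have h2 : dist y x₀ ≤ (max ⌈dist x x₀⌉₊ ⌈dist y x₀⌉₊ : ℕ) :=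
      (Nat.le_ceil _).trans (by exact_mod_cast le_max_right _ _)
    obtain ⟨V, hV, h⟩ := τ.exists_cell (max ⌈dist x x₀⌉₊ ⌈dist y x₀⌉₊)
    exact ⟨_, V, hV, h x h1, h y h2⟩
  obtain ⟨V, hV, hx, hy⟩ := Nat.find_spec hex
  have hmin : ∀ j < Nat.find hex, ∀ W ∈ τ.sets j, x ∈ W → y ∈ W → False :=
    fun j hj W hW hxW hyW => Nat.find_min hex hj ⟨W, hW, hxW, hyW⟩
  generalize Nat.find hex = N at hV hmin
  let e : τ.Cell := ⟨(N, V), hV⟩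
  have hx' : x ∈ e.1.2 := hx
  have hy' : y ∈ e.1.2 := hy
  have h1 : (τ.entry N x : ℝ) ≤ τ.entry 0 x + 3 * (dist x y + 1) := by
    refine τ.entry_le (fun j hj hlt => ?_) hD
    obtain ⟨W, hW, hxW⟩ := ((τ.isLevel j).depth_lt_iff x).1 hlt
    exact (τ.isLevel j).le_depth_add W hW x hxW y (hmin j hj W hW hxW)
  have h2 : (τ.entry N y : ℝ) ≤ τ.entry 0 y + 3 * (dist x y + 1) := by
    refine τ.entry_le (fun j hj hlt => ?_) hD
    obtain ⟨W, hW, hyW⟩ := ((τ.isLevel j).depth_lt_iff y).1 hlt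
    rw [dist_comm]
    exact (τ.isLevel j).le_depth_add W hW y hyW x fun hxW => hmin j hj W hW hxW hyW
  have h3 : |(τ.entry N x : ℝ) - τ.entry N y| ≤ dist x y + 1 := by
    have h4 := (τ.isLevel N).abs_depth_sub_le x y
    have h5 : (τ.edgeTree.base e : ℝ) + τ.depth N x = τ.entry N x := τ.base_eq e hx'
    have h6 : (τ.edgeTree.base e : ℝ) + τ.depth N y = τ.entry N y := τ.base_eq e hy'
    rwa [← h5, ← h6, add_sub_add_left_eq_sub]
  have hJ : τ.edgeTree.decorate.heightTree.join (τ.toTree x) (τ.toTree y) ≤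
      max (τ.entry N x : ℝ) (τ.entry N y) := by
    have l1 : (τ.toTree x).ht ≤ max (τ.entry N x : ℝ) (τ.entry N y) :=
      (τ.ht_toTree_le N x).trans (le_max_left _ _)
    have l2 : (τ.toTree y).ht ≤ max (τ.entry N x : ℝ) (τ.entry N y) :=
      (τ.ht_toTree_le N y).trans (le_max_right _ _)
    refine τ.edgeTree.decorate.heightTree.join_le l1 l2 ?_
    have hlt : max (τ.entry N x : ℝ) (τ.entry N y) < τ.edgeTree.top e :=
      max_lt (τ.entry_lt_top e hx') (τ.entry_lt_top e hy')
    ext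
    · rw [τ.edge_up_toTree hx' (le_max_left _ _) hlt, τ.edge_up_toTree hy' (le_max_right _ _) hlt]
    · rw [EdgeTree.ht_up _ l1, EdgeTree.ht_up _ l2]
  rw [τ.edgeTree.decorate.heightTree.dist_eq, EdgeTree.height_def, EdgeTree.height_def,
    ht_toTree, ht_toTree]
  rw [abs_le] at h3
  -- The constant is `7 = 3 + 1 + 3`: two climbs and the difference of the entries.
  rcases le_max_iff.1 hJ with h4 | h4 <;> linarith

/-- At depth `0` the ray of `x` traverses the whole edge of `V`. The ray of `y` never runs on this
edge, since all rays that do come from points of `V`; so the rays merge only at its upper end or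
above. -/
theorem le_dist_toTree {k : ℕ} {x y : X} (hx : τ.depth k x = 0) {V : Set X} (hV : V ∈ τ.sets k)
    (hxV : x ∈ V) (hyV : y ∉ V) : (2 : ℝ) ^ k ≤ dist (τ.toTree x) (τ.toTree y) := by
  let e : τ.Cell := ⟨(k, V), hV⟩
  have hxe : x ∈ e.1.2 := hxV
  have hb : (τ.edgeTree.base e : ℝ) = τ.entry k x := by
    have h1 : (τ.edgeTree.base e : ℝ) + τ.depth k x = τ.entry k x := τ.base_eq e hxe
    rw [← h1, hx, Nat.cast_zero, add_zero]
  have ht : (τ.edgeTree.top e : ℝ) = τ.entry k x + 2 ^ k := by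
    rw [EdgeTree.top, ← hb]; push_cast; rfl
  have hJ : (τ.edgeTree.top e : ℝ) ≤
      τ.edgeTree.decorate.heightTree.join (τ.toTree x) (τ.toTree y) := by
    by_contra hJ
    rw [not_le] at hJ
    refine hyV (τ.mem_of_edge_up_toTree (e := e) (t := max (τ.entry k x)
      (τ.edgeTree.decorate.heightTree.join (τ.toTree x) (τ.toTree y))) ?_)
    rw [← τ.edgeTree.decorate.heightTree.up_eq_up (le_max_right _ _)]
    exact τ.edge_up_toTree hxe (le_max_left _ _) (max_lt (τ.entry_lt_top e hxe) hJ)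
  have h1 : (τ.toTree y).ht ≤ τ.edgeTree.decorate.heightTree.join (τ.toTree x) (τ.toTree y) :=
    τ.edgeTree.decorate.heightTree.le_join_right (τ.toTree x) (τ.toTree y)
  have h2 := τ.ht_toTree_le k x
  rw [τ.edgeTree.decorate.heightTree.dist_eq, EdgeTree.height_def, EdgeTree.height_def]
  linarith

/-- A point of depth `0` in the level `k` is retracted to the lower end of an edge of level `k`. -/
theorem exists_canonicalRetract {j : ℕ} {x : X} (hx : τ.depth (j + 1) x = 0) :
    ∃ y, CanonicalRetract (τ.edgeTree.decorate.levelSet (j + 1)) (τ.toTree x) y ∧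
      y ∈ frontier (τ.edgeTree.decorate.levelSet j \ τ.edgeTree.decorate.levelSet (j + 1)) := by
  obtain ⟨V, hV, hxV⟩ := ((τ.isLevel (j + 1)).depth_lt_iff x).1 (by rw [hx]; positivity)
  let e : τ.Cell := ⟨(j + 1, V), hV⟩
  have hxe : x ∈ e.1.2 := hxV
  have hb : (τ.edgeTree.decorate.base (Sum.inl e) : ℝ) = τ.entry (j + 1) x := by
    have h1 : (τ.edgeTree.base e : ℝ) + τ.depth (j + 1) x = τ.entry (j + 1) x := τ.base_eq e hxe
    rw [← h1, hx, Nat.cast_zero, add_zero]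
    rfl
  have hle : (τ.toTree x).ht ≤ τ.edgeTree.decorate.base (Sum.inl e) := by
    rw [hb]; exact τ.ht_toTree_le _ x
  refine ⟨τ.edgeTree.decorate.bot (Sum.inl e),
    EdgeTree.canonicalRetract_bot _ (e := Sum.inl e) rfl hle ?_,
    EdgeTree.bot_mem_frontier τ.edgeTree.isBranched_decorate ⟨e, rfl⟩ rfl⟩
  ext
  · rw [hb, τ.edge_up_toTree hxe le_rfl (τ.entry_lt_top e hxe)]
    rfl
  · rw [EdgeTree.ht_up _ hle]
    rfl

end Tower

/-! ### Control functions and the embedding theorem. -/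

/-- A criterion for large scale embeddings. -/
lemma isLargeScaleEmbedding_of_dist_le {X Y : Type*} [MetricSpace X] [MetricSpace Y] {f : X → Y}
    (hf : ∀ x y, dist (f x) (f y) ≤ 7 * (dist x y + 1))
    (hf' : ∀ k : ℕ, ∃ C : ℝ, ∀ x y, dist (f x) (f y) < 2 ^ k → dist x y ≤ C) :
    IsLargeScaleEmbedding f := by
  classical
  choose C hC using hf'
  -- The lower control function counts the scales `k` with `C k < r`; the bound `⌈r⌉₊` keeps the
  -- count finite. A counted `k` forces the image distance to be at least `2 ^ k ≥ k + 1`, so the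
  -- count does not exceed the image distance.
  have hmono : Monotone fun r : ℝ≥0 =>
      (((Finset.range ⌈r⌉₊).filter fun k => C k < r).card : ℝ≥0) := by
    intro r s hrs
    refine Nat.cast_le.2 (Finset.card_le_card fun k hk => ?_)
    rw [Finset.mem_filter, Finset.mem_range] at hk ⊢
    exact ⟨hk.1.trans_le (Nat.ceil_mono hrs), hk.2.trans_le hrs⟩
  have hmono₂ : Monotone fun r : ℝ≥0 => 7 * (r + 1) := fun r s hrs => by
    change 7 * (r + 1) ≤ 7 * (s + 1)
    gcongr
  refine ⟨_, _, hmono, hmono₂, tendsto_atTop_atTop_of_monotone hmono fun b => ?_,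
    tendsto_atTop_atTop_of_monotone hmono₂ fun b => ⟨b, ?_⟩, fun x y => ⟨?_, ?_⟩⟩
  · refine ⟨⌈b⌉₊ + ∑ k ∈ Finset.range ⌈b⌉₊, (C k).toNNReal + 1, (Nat.le_ceil b).trans ?_⟩
    refine Nat.cast_le.2 ((Finset.card_range _).symm.le.trans (Finset.card_le_card fun k hk => ?_))
    rw [Finset.mem_filter, Finset.mem_range]
    constructor
    · refine (Finset.mem_range.1 hk).trans_le ((Nat.ceil_natCast (R := ℝ≥0) _).symm.le.trans
        (Nat.ceil_mono ?_))
      rw [add_assoc]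
      exact le_self_add
    · have h1 : (C k).toNNReal ≤ ∑ k ∈ Finset.range ⌈b⌉₊, (C k).toNNReal :=
        Finset.single_le_sum (f := fun k => (C k).toNNReal) (fun _ _ => zero_le) hk
      have h2 : (C k) ≤ (∑ k ∈ Finset.range ⌈b⌉₊, (C k).toNNReal : ℝ≥0) :=
        (Real.le_coe_toNNReal _).trans (by exact_mod_cast h1)
      have h3 : (0 : ℝ) ≤ ⌈b⌉₊ := Nat.cast_nonneg _
      push_cast at h2 ⊢
      linarith
  · calc b ≤ 1 * (b + 1) := by rw [one_mul]; exact le_self_add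
      _ ≤ 7 * (b + 1) := by gcongr; norm_num
  · refine (Nat.cast_le.2 (Finset.card_le_card (t := Finset.range ⌊nndist (f x) (f y)⌋₊)
      fun k hk => ?_)).trans ?_
    · rw [Finset.mem_filter, coe_nndist] at hk
      have h1 : (2 : ℝ) ^ k ≤ dist (f x) (f y) := by
        by_contra h
        exact absurd (hC k x y (not_le.1 h)) (not_le.2 hk.2)
      rw [Finset.mem_range]
      refine Nat.lt_of_succ_le (Nat.le_floor ?_)
      rw [← NNReal.coe_le_coe, coe_nndist, NNReal.coe_natCast]
      refine le_trans ?_ h1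
      exact_mod_cast Nat.lt_two_pow_self (n := k)
    · rw [Finset.card_range]
      exact Nat.floor_le zero_le
  · rw [← NNReal.coe_le_coe]
    push_cast
    exact hf x y

/-- The embedding theorem for nonempty spaces. -/
theorem AsdimLE.exists_embedding {n : ℕ} {X : Type u} [MetricSpace X] [ProperSpace X]
    (hX : AsdimLE X n) (x₀ : X) :
    ∃ (T : Fin (n + 1) → Type u) (_ : ∀ i, MetricSpace (T i)) (F : ∀ i, ℕ → Set (T i)),
      (∀ i, IsLocallyFiniteTree (T i) ∧ IsBinaryRegularTree (F i)) ∧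
      ∃ f : X → treeSkeleton F, IsLargeScaleEmbedding f := by
  obtain ⟨τ, hτ⟩ := hX.exists_tower x₀
  have hne : ∀ i, Nonempty (τ i).Cell := fun i => ⟨((τ i).exists_minimal_cell x₀).choose⟩
  refine ⟨fun i => (τ i).edgeTree.decorate.Point, inferInstance,
    fun i => (τ i).edgeTree.decorate.levelSet, fun i =>
      ⟨EdgeTree.isLocallyFiniteTree _, EdgeTree.isBinaryRegularTree (τ i).edgeTree.isBranched_decorate⟩,
    fun x => ⟨fun i => (τ i).toTree x, fun j => ?_⟩,
    isLargeScaleEmbedding_of_dist_le (fun x y => ?_) fun k => ?_⟩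
  · obtain ⟨i, hi⟩ := hτ (j + 1) x
    exact ⟨i, (τ i).exists_canonicalRetract hi⟩
  · rw [Subtype.dist_eq, dist_pi_le_iff (by positivity)]
    exact fun i => (τ i).dist_toTree_le x y
  · choose C hC using fun i => (τ i).exists_bound k
    refine ⟨∑ i, |C i|, fun x y hxy => ?_⟩
    -- In a colour where `x` has depth `0` at level `k`, images closer than `2 ^ k` force `y` into
    -- the same member, which is bounded by `C i`.
    obtain ⟨i, hi⟩ := hτ k x
    obtain ⟨V, hV, hxV⟩ := (((τ i).isLevel k).depth_lt_iff x).1 (by rw [hi]; positivity)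
    have hyV : y ∈ V := by
      by_contra hyV
      have h1 := (τ i).le_dist_toTree hi hV hxV hyV
      rw [Subtype.dist_eq] at hxy
      exact absurd (h1.trans (dist_le_pi_dist (fun i => (τ i).toTree x) (fun i => (τ i).toTree y) i))
        (not_le.2 hxy)
    calc dist x y ≤ C i := hC i V hV x hxV y hyV
      _ ≤ |C i| := le_abs_self _
      _ ≤ ∑ i, |C i| := Finset.single_le_sum (f := fun i => |C i|) (fun _ _ => abs_nonneg _)
        (Finset.mem_univ i)

/-- The embedding theorem. The empty space maps to the trees of a one-point space. -/
theorem AsdimLE.exists_trees {n : ℕ} {X : Type u} [MetricSpace X] [ProperSpace X]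
    (hX : AsdimLE X n) :
    ∃ (T : Fin (n + 1) → Type u) (_ : ∀ i, MetricSpace (T i)) (F : ∀ i, ℕ → Set (T i)),
      (∀ i, IsLocallyFiniteTree (T i) ∧ IsBinaryRegularTree (F i)) ∧
      ∃ f : X → treeSkeleton F, IsLargeScaleEmbedding f := by
  rcases isEmpty_or_nonempty X with hE | ⟨⟨x₀⟩⟩
  · have hP : AsdimLE PUnit.{u + 1} n := fun D _ => ⟨fun _ => {univ},
      fun x => ⟨0, univ, rfl, mem_univ x⟩, ⟨0, fun _ _ _ a _ b _ => (dist_self a).le⟩,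
      fun _ A hA B hB hAB => absurd (Eq.trans hA (Eq.symm hB)) hAB⟩
    obtain ⟨T, hT, F, hF, -⟩ := hP.exists_embedding PUnit.unit
    exact ⟨T, hT, F, hF, fun x => isEmptyElim x, isLargeScaleEmbedding_of_dist_le
      (fun x => isEmptyElim x) fun _ => ⟨0, fun x => isEmptyElim x⟩⟩
  · exact hX.exists_embedding x₀

theorem theoremt (n : ℕ) :
    (∀ (X : Type u) [MetricSpace X] [ProperSpace X], AsdimLE X n →
      ∃ (T : Fin (n + 1) → Type u) (_ : ∀ i, MetricSpace (T i)) (F : ∀ i, ℕ → Set (T i)),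
        (∀ i, IsLocallyFiniteTree (T i) ∧ IsBinaryRegularTree (F i)) ∧
        ∃ f : X → treeSkeleton F, IsLargeScaleEmbedding f) ∧
    MetricClass.IsUniversalFor (skeletonClass.{u} n) (properAsdimClass.{u} n) := by
  refine ⟨fun X _ _ hX => hX.exists_trees, ?_⟩
  rintro X _ ⟨hP, hX⟩
  obtain ⟨T, hT, F, hF, f, hf⟩ := hX.exists_trees
  exact ⟨treeSkeleton F, inferInstance,
    ⟨T, hT, F, fun i => (hF i).1.1, fun i => ⟨_, (hF i).2⟩, ⟨IsometryEquiv.refl _⟩⟩, f, hf⟩
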